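/- Setting. Let $X$ be a finite set of points and let $S:X\times X\to\mathbb R$ be a symmetric similarity function; for nonempty finite $A,B\subseteq X$ let $S(A,B)=\frac1{|A||B|}\sum_{x\in A,y\in B}S(x,y)$. A clustering of $X$ is a partition of $X$ into nonempty clusters. Let $\mathcal C^*$ be a target clustering with $k$ clusters that is stable: for all distinct $D,D'\in\mathcal C^*$, all nonempty $A\subsetneq D$ and all nonempty $A'\subseteq D'$, $S(A,D\setminus A)>S(A,A')$. Let $T$ be an average-linkage tree of $X$: start with the one-point trees and repeatedly join two trees with point sets $N_1,N_2$ that maximize $S(N_1,N_2)$ under a new root (ties broken arbitrarily) until one tree is left. For a set $A$ of at least two points, let $\mathrm{Split}(A)=\{N_1\cap A,N_2\cap A\}$, where $N_1,N_2$ are the children of the deepest node of $T$ that contains $A$. Algorithms. Starting from an initial clustering $\mathcal C_0$, the current clustering $\mathcal C$ is edited as follows. On a request split$(A)$, the cluster $A$ is replaced by the two sets of $\mathrm{Split}(A)$. On a request merge$(A,B)$, the clusters $A,B$ are replaced by $A\cup B$ if $\mathrm{Split}(A\cup B)=\{A,B\}$, and by the two sets of $\mathrm{Split}(A\cup B)$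 otherwise. Requests (unrestricted-merge model with random merges). As long as $\mathcal C\neq\mathcal C^*$, the user makes one feasible request in each round. The request split$(A)$ is feasible if $A\in\mathcal C$ contains points of at least two target clusters; the request merge$(A,B)$, for an unordered pair of distinct $A,B\in\mathcal C$, is feasible if some target cluster has points both in $A$ and in $B$. The choice between a split and a merge, and the choice of the split, are arbitrary (possibly random, and possibly depending on the whole history), but given the history and the event that a merge is requested, the requested pair is uniformly distributed on the set of currently feasible merges. Natural errors. A natural clustering error is a function $\gamma$ that assigns to a clustering $\mathcal C$ and a target clustering $\mathcal C^*$ a nonnegative integer $\gamma(\mathcal C,\mathcal C^*)$ such that (i) if $A\in\mathcal C$ contains points of $D\in\mathcal C^*$ and also points of other target clusters, then replacing $A$ by $A\cap D$ and $A\setminus D$ strictly decreases the error, and (ii) if two distinct clusters of $\mathcal C$ are contained in the same target cluster, then replacing them by their union strictly decreases the error. Theorem. There is a universal constant $K>0$ such that, for all $X,S,\mathcal C^*,T,\mathcal C_0$ as above, every user as above, every natural clustering error $\gamma$, and every $\varepsilon\in(0,1)$ with $k/\varepsilon\ge 2$ (that is, $k\ge2$ or $\varepsilon\le\frac12$), with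 probability at least $1-\varepsilon$ the target clustering $\mathcal C^*$ is found after at most $$K\,\log\!\Big(\frac{k}{\varepsilon}\Big)\,\gamma(\mathcal C_0,\mathcal C^*)^2$$ edit requests (splits and merges together). -/

import Mathlib

namespace InteractiveClustering

/-- A clustering of the data set `X`: a partition of `X` into nonempty, pairwise disjoint
clusters. -/
abbrev Clustering (X : Type*) [Fintype X] [DecidableEq X] :=
  Finpartition (Finset.univ : Finset X)

/-- The average similarity `S(A, B)` between the points of `A` and the points of `B`. -/
noncomputable def avgSim {X : Type*} (S : X → X → ℝ) (A B : Finset X) : ℝ :=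
  (∑ x ∈ A, ∑ y ∈ B, S x y) / ((A.card : ℝ) * (B.card : ℝ))

/-- Stability of a clustering with respect to a similarity function: for distinct clusters
`D, D'`, every nonempty proper subset `A` of `D` and every nonempty subset `A'` of `D'`,
`S(A, D \ A) > S(A, A')`. -/
def IsStable {X : Type*} [Fintype X] [DecidableEq X]
    (S : X → X → ℝ) (C : Clustering X) : Prop :=
  ∀ D ∈ C.parts, ∀ D' ∈ C.parts, D ≠ D' →
    ∀ A A' : Finset X, A.Nonempty → A ⊂ D → A'.Nonempty → A' ⊆ D' →
      avgSim S A A' < avgSim S A (D \ A)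

/-! ### Average linkage -/

/-- Hierarchical clustering trees: leaves carry points, inner nodes have two children. -/
inductive HTree (X : Type*) where
  | leaf (x : X) : HTree X
  | node (l r : HTree X) : HTree X

/-- The set of points contained in (the root of) a tree. -/
def HTree.points {X : Type*} [DecidableEq X] : HTree X → Finset X
  | .leaf x => {x}
  | .node l r => l.points ∪ r.points

/-- One iteration of average linkage on the current forest: two most similar nodes (ties broken
arbitrarily) are joined under a new node. -/
def AvgLinkageStep {X : Type*} [DecidableEq X] (S : X → X → ℝ)
    (F F' : Multiset (HTree X)) : Prop :=
  ∃ (N₁ N₂ : HTree X) (R : Multiset (HTree X)),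
    F = N₁ ::ₘ N₂ ::ₘ R ∧
    (∀ (M₁ M₂ : HTree X) (R' : Multiset (HTree X)), F = M₁ ::ₘ M₂ ::ₘ R' →
      avgSim S M₁.points M₂.points ≤ avgSim S N₁.points N₂.points) ∧
    F' = HTree.node N₁ N₂ ::ₘ R

/-- `T` is a (global) average-linkage tree of `X`: it is the single tree left when average linkage
is run from the forest of all one-point trees. -/
def IsAvgLinkageTree {X : Type*} [Fintype X] [DecidableEq X] (S : X → X → ℝ)
    (T : HTree X) : Prop :=
  Relation.ReflTransGen (AvgLinkageStep S)
    ((Finset.univ : Finset X).val.map HTree.leaf) {T}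

/-! ### The split and merge procedures -/

/-- Follow the points of `A` down the tree to the node at which they are first split in two, and
return the parts of `A` in the two children of this node. (The value at a leaf is never used:
a set with two points of the tree is split above the leaves.) -/
def HTree.splitSet {X : Type*} [DecidableEq X] : HTree X → Finset X → Finset X × Finset X
  | .leaf _, A => (A, ∅)
  | .node l r, A =>
    if A ⊆ l.points then l.splitSet A
    else if A ⊆ r.points then r.splitSet A
    else (l.points ∩ A, r.points ∩ A)

/-- Split procedure: replace the cluster `A` by the two parts found in the tree. -/
def splitProc {X : Type*} [DecidableEq X] (T : HTree X) (C : Finset (Finset X))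
    (A : Finset X) : Finset (Finset X) :=
  C.erase A ∪ {(T.splitSet A).1, (T.splitSet A).2}

/-- Merge procedure for the unordered pair of clusters `M = {A, B}`: split the union `A ∪ B` with
the tree; if the two parts are again `A` and `B`, replace `A` and `B` by `A ∪ B`, and otherwise
replace them by the two parts. -/
def mergeProc {X : Type*} [DecidableEq X] (T : HTree X) (C : Finset (Finset X))
    (M : Finset (Finset X)) : Finset (Finset X) :=
  if ({(T.splitSet (M.sup id)).1, (T.splitSet (M.sup id)).2} : Finset (Finset X)) = M then
    (C \ M) ∪ {M.sup id}
  else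
    (C \ M) ∪ {(T.splitSet (M.sup id)).1, (T.splitSet (M.sup id)).2}

/-! ### Requests and the unrestricted-merge model -/

/-- Edit requests: split a cluster, or merge an unordered pair `{A, B}` of clusters. -/
inductive Request (X : Type*) where
  | split (A : Finset X) : Request X
  | merge (M : Finset (Finset X)) : Request X

/-- A split of `A` is feasible if `A` is a current cluster that contains points from two or more
target clusters. -/
def FeasibleSplit {X : Type*} [Fintype X] [DecidableEq X]
    (Cstar : Clustering X) (C : Finset (Finset X)) (A : Finset X) : Prop :=
  A ∈ C ∧ ∃ D ∈ Cstar.parts, ∃ D' ∈ Cstar.parts, D ≠ D' ∧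
    (A ∩ D).Nonempty ∧ (A ∩ D').Nonempty

/-- A merge of the pair `M` is feasible if `M` consists of two distinct current clusters that both
contain at least one point of a common target cluster. -/
def FeasibleMerge {X : Type*} [Fintype X] [DecidableEq X]
    (Cstar : Clustering X) (C : Finset (Finset X)) (M : Finset (Finset X)) : Prop :=
  M ⊆ C ∧ M.card = 2 ∧ ∃ D ∈ Cstar.parts, ∀ A ∈ M, (A ∩ D).Nonempty

/-- Feasible requests of the unrestricted-merge model. -/
def Feasible {X : Type*} [Fintype X] [DecidableEq X]
    (Cstar : Clustering X) (C : Finset (Finset X)) : Request X → Prop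
  | .split A => FeasibleSplit Cstar C A
  | .merge M => FeasibleMerge Cstar C M

/-- The response of the algorithm to a request. -/
def respond {X : Type*} [DecidableEq X] (T : HTree X) (C : Finset (Finset X)) :
    Request X → Finset (Finset X)
  | .split A => splitProc T C A
  | .merge M => mergeProc T C M

/-- The current clustering after the requests in `h` (most recent request first), starting from
the clustering `C₀`. -/
def current {X : Type*} [DecidableEq X] (T : HTree X) (C₀ : Finset (Finset X)) :
    List (Request X) → Finset (Finset X)
  | [] => C₀
  | r :: h => respond T (current T C₀ h) r

/-- The law of the request history after `n` rounds. The user is given by the conditional law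
`user h` of the next request given the history `h` of all earlier requests. The interaction stops
(no further request is made) as soon as the target clustering is found. -/
noncomputable def history {X : Type*} [Fintype X] [DecidableEq X] (T : HTree X)
    (Cstar C₀ : Clustering X) (user : List (Request X) → PMF (Request X)) :
    ℕ → PMF (List (Request X))
  | 0 => PMF.pure []
  | n + 1 => (history T Cstar C₀ user n).bind fun h =>
      if current T C₀.parts h = Cstar.parts then PMF.pure h
      else (user h).map fun r => r :: h

/-- The user follows the unrestricted-merge model with uniformly random merge requests: at every
history that occurs with positive probability and has not yet reached the target, only feasible
requests are made, and all merges that are feasible at this moment are equally likely to be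
requested. The split requests, and the choice between splitting and merging, are arbitrary: they
may be random and may depend on the whole history. -/
def IsUnrestrictedRandomMergeUser {X : Type*} [Fintype X] [DecidableEq X] (T : HTree X)
    (Cstar C₀ : Clustering X) (user : List (Request X) → PMF (Request X)) : Prop :=
  ∀ (n : ℕ), ∀ h ∈ (history T Cstar C₀ user n).support,
    current T C₀.parts h ≠ Cstar.parts →
      (∀ r ∈ (user h).support, Feasible Cstar (current T C₀.parts h) r) ∧
      (∀ M M' : Finset (Finset X),
        FeasibleMerge Cstar (current T C₀.parts h) M →
        FeasibleMerge Cstar (current T C₀.parts h) M' →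
        user h (Request.merge M) = user h (Request.merge M'))

/-- The probability that the target clustering is found with at most `n` edit requests. -/
noncomputable def probFoundWithin {X : Type*} [Fintype X] [DecidableEq X] (T : HTree X)
    (Cstar C₀ : Clustering X) (user : List (Request X) → PMF (Request X)) (n : ℕ) : ENNReal :=
  (history T Cstar C₀ user n).toOuterMeasure {h | current T C₀.parts h = Cstar.parts}

/-! ### Natural clustering errors -/

/-- `γ C Cstar` is a natural clustering error of the clustering `C` with respect to the target
`Cstar`: a nonnegative integer that decreases when a cluster `A` containing points of a target
cluster `D` and other points is split into `A ∩ D` and `A \ D`, and when two clusters contained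
in a common target cluster are merged. -/
structure IsNaturalError {X : Type*} [Fintype X] [DecidableEq X]
    (γ : Clustering X → Clustering X → ℤ) : Prop where
  nonneg : ∀ C Cstar : Clustering X, 0 ≤ γ C Cstar
  split_lt : ∀ (Cstar C C' : Clustering X), ∀ A ∈ C.parts, ∀ D ∈ Cstar.parts,
    (A ∩ D).Nonempty → (A \ D).Nonempty →
    C'.parts = C.parts.erase A ∪ {A ∩ D, A \ D} → γ C' Cstar < γ C Cstar
  merge_lt : ∀ (Cstar C C' : Clustering X), ∀ A ∈ C.parts, ∀ B ∈ C.parts, A ≠ B →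
    (∃ D ∈ Cstar.parts, A ⊆ D ∧ B ⊆ D) →
    C'.parts = (C.parts \ {A, B}) ∪ {A ∪ B} → γ C' Cstar < γ C Cstar

end InteractiveClustering

open InteractiveClustering

/-! By stability, a proper part of a target cluster `D` is more similar to the rest of `D` than to
anything outside `D`. Average linkage therefore completes `D` before leaving it, and every node of
the tree is laminar with respect to the target (`isLaminar_of_isAvgLinkageTree`). Hence the tree
never cuts a target cluster when it splits a set contained in no single target cluster
(`splitSet_clean`).

Progress is measured by an integer potential. It counts the incidences between clusters and target
clusters with weight 3, and the incidences where a cluster meets both tree halves of a target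
cluster `D` with weight 1; from this it subtracts the number of clusters and the value at the
target. A clean split gains 1 through the extra cluster. Joining `A` and `B` that share `D` gains at
least 3 - 1 there and loses at most 1 through the cluster count. A failed merge inside `D` removes
all straddling of the halves. So no feasible request increases the potential, and only merges inside
one half of a target cluster can leave it unchanged (`respond_spec`).

Such a bad merge `{A, B}` inside a half of `D` is charged to a good merge `{A, Z}`, where `Z`
reaches the other half. At most `N` bad merges are charged to one ordered pair `(A, Z)`, where `N`
bounds the number of clusters meeting a target cluster, so the bad merges number at most `2 * N`
times the good ones (`card_merge_le`). Since `N` can be taken as the initial potential plus 1, the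
mean of `2 ^ potential` shrinks in each round by a factor `1 - 1 / (2 * (2 * N + 1))`
(`expPotential_step`), and a Markov argument bounds the failure probability (`le_probFoundWithin`).

Finally, any natural error is at least the number of cuts along target clusters and joins of pure
clusters needed to reach the target, and the potential is at most 4 times this number. Thus `N` is
linear in the error: order `N` rounds gain a constant factor, order `N` such factors offset `2 ^ N`,
and this gives the quadratic bound. -/

namespace InteractiveClustering

/-! ### Stability makes average linkage respect the target clusters. -/

section Laminar

variable {X : Type*} [Fintype X] [DecidableEq X]

/-- `N` is laminar with respect to the clustering `C`: it contains, is contained in, or is disjoint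
from each cluster. -/
def Laminar (C : Clustering X) (N : Finset X) : Prop :=
  ∀ D ∈ C.parts, Disjoint N D ∨ N ⊆ D ∨ D ⊆ N

/-- The children of every inner node of the tree are disjoint and laminar. -/
def HTree.IsLaminar (C : Clustering X) : HTree X → Prop
  | .leaf _ => True
  | .node l r => Disjoint l.points r.points ∧ Laminar C l.points ∧ Laminar C r.points ∧
      l.IsLaminar C ∧ r.IsLaminar C

theorem HTree.points_nonempty {X : Type*} [DecidableEq X] (t : HTree X) : t.points.Nonempty := by
  induction t with
  | leaf x => exact Finset.singleton_nonempty x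
  | node l r hl _ => exact hl.mono Finset.subset_union_left

theorem laminar_singleton (C : Clustering X) (x : X) : Laminar C {x} := by
  intro D _
  by_cases h : x ∈ D
  · exact Or.inr (Or.inl (Finset.singleton_subset_iff.2 h))
  · exact Or.inl (Finset.disjoint_singleton_left.2 h)

theorem exists_mem_parts (C : Clustering X) (x : X) : ∃ D ∈ C.parts, x ∈ D :=
  C.exists_mem (Finset.mem_univ x)

theorem avgSim_comm {X : Type*} {S : X → X → ℝ} (hS : ∀ x y, S x y = S y x) (A B : Finset X) :
    avgSim S A B = avgSim S B A := by
  unfold avgSim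
  rw [Finset.sum_comm, mul_comm]
  congr 1
  exact Finset.sum_congr rfl fun y _ => Finset.sum_congr rfl fun x _ => hS x y

/-- Clearing denominators turns a bound on an average into the sign of a sum that is additive in
`B`, so such bounds can be added over disjoint sets. -/
theorem avgSim_le_iff {X : Type*} (S : X → X → ℝ) {A B : Finset X} (hA : A.Nonempty) (hB : B.Nonempty)
    (m : ℝ) : avgSim S A B ≤ m ↔ ∑ y ∈ B, (∑ x ∈ A, S x y - m * A.card) ≤ 0 := by
  have h1 : (0 : ℝ) < A.card := by exact_mod_cast hA.card_pos
  have h2 : (0 : ℝ) < B.card := by exact_mod_cast hB.card_pos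
  unfold avgSim
  rw [div_le_iff₀ (by positivity), Finset.sum_comm, Finset.sum_sub_distrib, Finset.sum_const,
    nsmul_eq_mul, sub_nonpos]
  constructor <;> intro h <;> linarith

/-- In a stable clustering, a proper part of a cluster is more similar to the rest of its cluster
than to any set of points outside. -/
theorem IsStable.avgSim_lt {S : X → X → ℝ} {C : Clustering X} (hC : IsStable S C)
    {D A B : Finset X} (hD : D ∈ C.parts) (hA : A.Nonempty) (hAD : A ⊂ D) (hB : B.Nonempty)
    (hBD : Disjoint B D) : avgSim S A B < avgSim S A (D \ A) := by
  have h1 : (0 : ℝ) < A.card := by exact_mod_cast hA.card_pos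
  have h2 : (0 : ℝ) < B.card := by exact_mod_cast hB.card_pos
  -- `B` may spread over several target clusters, so stability is applied to each singleton `{y}`
  -- and the results are summed.
  have key : ∀ y ∈ B, ∑ x ∈ A, S x y < avgSim S A (D \ A) * A.card := by
    intro y hy
    obtain ⟨D', hD', hyD'⟩ := exists_mem_parts C y
    have hne : D ≠ D' := by
      rintro rfl
      exact Finset.disjoint_left.1 hBD hy hyD'
    have := hC D hD D' hD' hne A {y} hA hAD (Finset.singleton_nonempty y)
      (Finset.singleton_subset_iff.2 hyD')
    rw [avgSim, div_lt_iff₀ (by simpa using h1)] at this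
    simpa using this
  rw [avgSim, div_lt_iff₀ (by positivity), Finset.sum_comm]
  calc ∑ y ∈ B, ∑ x ∈ A, S x y < ∑ _y ∈ B, avgSim S A (D \ A) * A.card :=
        Finset.sum_lt_sum_of_nonempty hB key
    _ = _ := by rw [Finset.sum_const, nsmul_eq_mul]; ring

theorem sum_map_sum_map {α β : Type*} (R : Multiset α) (f : α → Multiset β) (g : β → ℝ) :
    (((R.map f).sum).map g).sum = (R.map fun t => ((f t).map g).sum).sum := by
  induction R using Multiset.induction_on with
  | empty => simp
  | cons a R ih => simp [ih]

/-- A proper part `N₁` of a target cluster is never joined with a set outside of this cluster. -/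
theorem not_join_outside {S : X → X → ℝ} {C : Clustering X} (hC : IsStable S C)
    {N₁ N₂ : HTree X} {R : Multiset (HTree X)}
    (hF : N₁.points.val + (N₂.points.val + (R.map fun t => t.points.val).sum)
      = (Finset.univ : Finset X).val)
    (hR : ∀ t ∈ R, Laminar C t.points ∧ Disjoint N₁.points t.points)
    (hmax : ∀ t ∈ R, avgSim S N₁.points t.points ≤ avgSim S N₁.points N₂.points)
    {D : Finset X} (hD : D ∈ C.parts) (h1 : N₁.points ⊂ D) (h2 : Disjoint N₂.points D) :
    False := by
  have hlt := hC.avgSim_lt hD N₁.points_nonempty h1 N₂.points_nonempty h2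
  set m := avgSim S N₁.points N₂.points with hm
  refine absurd hlt (not_lt.2 ?_)
  rw [avgSim_le_iff S N₁.points_nonempty (Finset.sdiff_nonempty.2 h1.2)]
  set s : X → ℝ := fun y => ∑ x ∈ N₁.points, S x y - m * N₁.points.card with hs
  -- `D \ N₁` is a disjoint union of trees of `R`. Restricting `s` to `D` lets the sum over the
  -- whole forest isolate these trees.
  set g : X → ℝ := fun y => if y ∈ D then s y else 0 with hg
  have hsum : ∑ y, g y = ∑ y ∈ N₁.points, g y + (∑ y ∈ N₂.points, g y +
      (R.map fun t => ∑ y ∈ t.points, g y).sum) := by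
    have := congrArg (fun u : Multiset X => (u.map g).sum) hF
    simp only [Multiset.map_add, Multiset.sum_add] at this
    rw [sum_map_sum_map] at this
    exact this.symm
  have hN1 : ∑ y ∈ N₁.points, g y = ∑ y ∈ N₁.points, s y :=
    Finset.sum_congr rfl fun y hy => if_pos (h1.1 hy)
  have hN2 : ∑ y ∈ N₂.points, g y = 0 :=
    Finset.sum_eq_zero fun y hy => if_neg (Finset.disjoint_left.1 h2 hy)
  have hRs : (R.map fun t => ∑ y ∈ t.points, g y).sum ≤ 0 := by
    refine Multiset.sum_induction (· ≤ 0) _ (fun _ _ => add_nonpos) le_rfl ?_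
    intro a ha
    obtain ⟨t, ht, rfl⟩ := Multiset.mem_map.1 ha
    obtain ⟨hl, hd⟩ := hR t ht
    rcases hl D hD with h | h | h
    · exact le_of_eq (Finset.sum_eq_zero fun y hy => if_neg (Finset.disjoint_left.1 h hy))
    · rw [Finset.sum_congr rfl fun y hy => if_pos (h hy)]
      exact (avgSim_le_iff S N₁.points_nonempty t.points_nonempty m).1 (hmax t ht)
    -- A tree containing all of `D` would meet `N₁`.
    · obtain ⟨x, hx⟩ := N₁.points_nonempty
      exact absurd (h (h1.1 hx)) (Finset.disjoint_left.1 hd hx)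
  have hDs : ∑ y, g y = ∑ y ∈ D, s y := by simp [hg]
  have := Finset.sum_sdiff (f := s) h1.1
  linarith

/-- Laminarity could fail only if a proper part of some `D` were joined with a set disjoint from
`D`; `not_join_outside` excludes this in both orders. -/
theorem laminar_union {S : X → X → ℝ} (hS : ∀ x y, S x y = S y x) {C : Clustering X}
    (hC : IsStable S C) {N₁ N₂ : HTree X} {R : Multiset (HTree X)}
    (hF : N₁.points.val + (N₂.points.val + (R.map fun t => t.points.val).sum)
      = (Finset.univ : Finset X).val)
    (h1 : Laminar C N₁.points) (h2 : Laminar C N₂.points)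
    (hR : ∀ t ∈ R, Laminar C t.points ∧ Disjoint N₁.points t.points ∧
      Disjoint N₂.points t.points)
    (hmax1 : ∀ t ∈ R, avgSim S N₁.points t.points ≤ avgSim S N₁.points N₂.points)
    (hmax2 : ∀ t ∈ R, avgSim S N₂.points t.points ≤ avgSim S N₁.points N₂.points) :
    Laminar C (N₁.points ∪ N₂.points) := by
  have aux : ∀ {N M : Finset X} {D : Finset X}, N.Nonempty → N ⊆ D → Disjoint N M →
      ¬ D ⊆ M := by
    intro N M D ⟨x, hx⟩ hND hNM h
    exact Finset.disjoint_left.1 hNM hx (h (hND hx))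
  have hF' : N₂.points.val + (N₁.points.val + (R.map fun t => t.points.val).sum)
      = (Finset.univ : Finset X).val := by
    rw [← hF]; exact add_left_comm _ _ _
  intro D hD
  by_cases hD1 : D ⊆ N₁.points
  · exact Or.inr (Or.inr (hD1.trans Finset.subset_union_left))
  by_cases hD2 : D ⊆ N₂.points
  · exact Or.inr (Or.inr (hD2.trans Finset.subset_union_right))
  rcases h1 D hD with h | h | h
  · rcases h2 D hD with h' | h' | h'
    · exact Or.inl (Finset.disjoint_union_left.2 ⟨h, h'⟩)
    · refine (not_join_outside hC hF' (fun t ht => ⟨(hR t ht).1, (hR t ht).2.2⟩) ?_ hD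
        ⟨h', hD2⟩ h).elim
      rw [avgSim_comm hS N₂.points]
      exact hmax2
    · exact absurd h' hD2
  · rcases h2 D hD with h' | h' | h'
    · exact (not_join_outside hC hF (fun t ht => ⟨(hR t ht).1, (hR t ht).2.1⟩) hmax1 hD
        ⟨h, hD1⟩ h').elim
    · exact Or.inr (Or.inl (Finset.union_subset h h'))
    · exact absurd h' hD2
  · exact absurd h hD1

/-- The invariant along the run is that the trees of the forest partition the points and that all
their nodes are laminar. Counting points as multisets records disjointness together with covering.
-/
theorem isLaminar_of_isAvgLinkageTree {S : X → X → ℝ} (hS : ∀ x y, S x y = S y x)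
    {C : Clustering X} (hC : IsStable S C) {T : HTree X} (hT : IsAvgLinkageTree S T) :
    T.IsLaminar C ∧ T.points = Finset.univ := by
  have key : ∀ F : Multiset (HTree X), Relation.ReflTransGen (AvgLinkageStep S)
      ((Finset.univ : Finset X).val.map HTree.leaf) F →
      (F.map fun t => t.points.val).sum = (Finset.univ : Finset X).val ∧
        ∀ t ∈ F, t.IsLaminar C ∧ Laminar C t.points := by
    intro F hF
    induction hF with
    | refl =>
      refine ⟨?_, ?_⟩
      · rw [Multiset.map_map]
        simp only [Function.comp_def, HTree.points, Finset.singleton_val]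
        exact Multiset.sum_map_singleton _
      · intro t ht
        obtain ⟨x, _, rfl⟩ := Multiset.mem_map.1 ht
        exact ⟨trivial, laminar_singleton C x⟩
    | tail _ hstep ih =>
      obtain ⟨N₁, N₂, R, rfl, hmax, rfl⟩ := hstep
      obtain ⟨hsum, hlam⟩ := ih
      rw [Multiset.map_cons, Multiset.map_cons, Multiset.sum_cons, Multiset.sum_cons] at hsum
      have hnd : (N₁.points.val + (N₂.points.val +
          (R.map fun t => t.points.val).sum)).Nodup := by
        rw [hsum]; exact Finset.univ.nodup
      obtain ⟨-, hnd2, hdis1⟩ := Multiset.nodup_add.1 hnd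
      obtain ⟨-, -, hdis2⟩ := Multiset.nodup_add.1 hnd2
      rw [Multiset.disjoint_add_right] at hdis1
      have hle : ∀ t ∈ R, t.points.val ≤ (R.map fun t => t.points.val).sum := fun t ht =>
        Multiset.single_le_sum (fun _ _ => Multiset.zero_le _) _ (Multiset.mem_map_of_mem _ ht)
      have hd : Disjoint N₁.points N₂.points := Finset.disjoint_val.1 hdis1.1
      have l1 := hlam N₁ (by simp)
      have l2 := hlam N₂ (by simp)
      have hun : Laminar C (N₁.points ∪ N₂.points) := by
        refine laminar_union hS hC hsum l1.2 l2.2 ?_ ?_ ?_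
        · intro t ht
          exact ⟨(hlam t (by simp [ht])).2,
            Finset.disjoint_val.1 (hdis1.2.mono_right (hle t ht)),
            Finset.disjoint_val.1 (hdis2.mono_right (hle t ht))⟩
        · intro t ht
          obtain ⟨R', rfl⟩ := Multiset.exists_cons_of_mem ht
          refine hmax N₁ t (N₂ ::ₘ R') ?_
          rw [Multiset.cons_swap t N₂]
        · intro t ht
          obtain ⟨R', rfl⟩ := Multiset.exists_cons_of_mem ht
          refine hmax N₂ t (N₁ ::ₘ R') ?_
          rw [Multiset.cons_swap t N₁, Multiset.cons_swap N₂ N₁]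
      refine ⟨?_, ?_⟩
      · rw [Multiset.map_cons, Multiset.sum_cons, ← hsum, ← add_assoc]
        congr 1
        simp only [HTree.points]
        rw [← Finset.disjUnion_eq_union _ _ hd]
        rfl
      · intro t ht
        rcases Multiset.mem_cons.1 ht with rfl | ht
        · exact ⟨⟨hd, l1.2, l2.2, l1.1, l2.1⟩, hun⟩
        · exact hlam t (by simp [ht])
  obtain ⟨h1, h2⟩ := key _ hT
  refine ⟨(h2 T (by simp)).1, ?_⟩
  apply Finset.val_injective
  simpa using h1

end Laminar

end InteractiveClustering

namespace InteractiveClustering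

/-! ### How the tree splits a set. -/

section SplitSet

variable {X : Type*} [Fintype X] [DecidableEq X]

/-- Where `splitSet` cuts a set with at least two points. -/
theorem HTree.IsLaminar.splitSet_spec {C : Clustering X} {T : HTree X} (hT : T.IsLaminar C)
    {A : Finset X} (hA : A ⊆ T.points) (h2 : 1 < A.card) :
    ∃ L R : Finset X, Disjoint L R ∧ Laminar C L ∧ Laminar C R ∧ A ⊆ L ∪ R ∧ ¬ A ⊆ L ∧ ¬ A ⊆ R ∧
      T.splitSet A = (L ∩ A, R ∩ A) := by
  induction T with
  | leaf x =>
    have := Finset.card_le_card hA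
    simp only [HTree.points, Finset.card_singleton] at this
    omega
  | node l r hl hr =>
    obtain ⟨hd, ll, lr, hl', hr'⟩ := hT
    rw [HTree.splitSet]
    split_ifs with h h'
    · exact hl hl' h
    · exact hr hr' h'
    · exact ⟨l.points, r.points, hd, ll, lr, hA, h, h', rfl⟩

/-- The two parts of a set. -/
theorem HTree.IsLaminar.splitSet_parts {C : Clustering X} {T : HTree X} (hT : T.IsLaminar C)
    {A : Finset X} (hA : A ⊆ T.points) :
    Disjoint (T.splitSet A).1 (T.splitSet A).2 ∧ (T.splitSet A).1 ∪ (T.splitSet A).2 = A := by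
  induction T with
  | leaf x => simp [HTree.splitSet]
  | node l r hl hr =>
    obtain ⟨hd, ll, lr, hl', hr'⟩ := hT
    rw [HTree.splitSet]
    split_ifs with h h'
    · exact hl hl' h
    · exact hr hr' h'
    · refine ⟨hd.mono Finset.inter_subset_left Finset.inter_subset_left, ?_⟩
      rw [← Finset.union_inter_distrib_right]
      exact Finset.inter_eq_right.2 hA

theorem HTree.IsLaminar.splitSet_nonempty {C : Clustering X} {T : HTree X} (hT : T.IsLaminar C)
    {A : Finset X} (hA : A ⊆ T.points) (h2 : 1 < A.card) :
    (T.splitSet A).1.Nonempty ∧ (T.splitSet A).2.Nonempty := by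
  obtain ⟨L, R, -, -, -, hLR, hL, hR, h⟩ := hT.splitSet_spec hA h2
  rw [h]
  constructor
  · obtain ⟨x, hx, hxR⟩ := Finset.not_subset.1 hR
    exact ⟨x, Finset.mem_inter.2 ⟨(Finset.mem_union.1 (hLR hx)).resolve_right hxR, hx⟩⟩
  · obtain ⟨x, hx, hxL⟩ := Finset.not_subset.1 hL
    exact ⟨x, Finset.mem_inter.2 ⟨(Finset.mem_union.1 (hLR hx)).resolve_left hxL, hx⟩⟩

/-- A set that is not contained in a target cluster is split without cutting target clusters. -/
theorem HTree.IsLaminar.splitSet_clean {C : Clustering X} {T : HTree X} (hT : T.IsLaminar C)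
    {A : Finset X} (hA : A ⊆ T.points) (h2 : 1 < A.card) (himp : ∀ D ∈ C.parts, ¬ A ⊆ D)
    {D : Finset X} (hD : D ∈ C.parts) :
    Disjoint (T.splitSet A).1 D ∨ Disjoint (T.splitSet A).2 D := by
  obtain ⟨L, R, hd, lL, lR, hLR, -, -, h⟩ := hT.splitSet_spec hA h2
  rw [h]
  by_contra! hcon
  obtain ⟨h1, h2⟩ := hcon
  obtain ⟨x, hx, hxD⟩ := Finset.not_disjoint_iff.1 h1
  obtain ⟨y, hy, hyD⟩ := Finset.not_disjoint_iff.1 h2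
  have hxL := (Finset.mem_inter.1 hx).1
  have hyR := (Finset.mem_inter.1 hy).1
  -- `L` meets `D` and cannot contain it, since the disjoint set `R` meets `D` too; laminarity
  -- leaves only `L ⊆ D`, and likewise for `R`.
  have hL : L ⊆ D := by
    rcases lL D hD with h | h | h
    · exact absurd hxD (Finset.disjoint_left.1 h hxL)
    · exact h
    · exact absurd hyR (Finset.disjoint_left.1 hd (h hyD))
  have hR : R ⊆ D := by
    rcases lR D hD with h | h | h
    · exact absurd hyD (Finset.disjoint_left.1 h hyR)
    · exact h
    · exact absurd (h hxD) (Finset.disjoint_left.1 hd hxL)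
  exact himp D hD (hLR.trans (Finset.union_subset hL hR))

/-- A subset of `D` that meets both parts of `D` is split like `D`. -/
theorem HTree.IsLaminar.splitSet_of_subset {C : Clustering X} {T : HTree X} (hT : T.IsLaminar C)
    {A D : Finset X} (hD : D ⊆ T.points) (hAD : A ⊆ D) (h1 : ¬ A ⊆ (T.splitSet D).1)
    (h2 : ¬ A ⊆ (T.splitSet D).2) :
    T.splitSet A = ((T.splitSet D).1 ∩ A, (T.splitSet D).2 ∩ A) := by
  induction T with
  -- At a leaf the first part of `D` is `D` itself, so `h1` contradicts `A ⊆ D`.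
  | leaf x => exact absurd hAD h1
  | node l r hl hr =>
    obtain ⟨hd, ll, lr, hl', hr'⟩ := hT
    rw [HTree.splitSet] at h1 h2 ⊢
    rw [HTree.splitSet]
    by_cases hDl : D ⊆ l.points
    · rw [if_pos hDl] at h1 h2 ⊢
      rw [if_pos (hAD.trans hDl)]
      exact hl hl' hDl h1 h2
    rw [if_neg hDl] at h1 h2 ⊢
    by_cases hDr : D ⊆ r.points
    · rw [if_pos hDr] at h1 h2 ⊢
      obtain ⟨x, hx, -⟩ := Finset.not_subset.1 h1
      have : ¬ A ⊆ l.points := fun h =>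
        Finset.disjoint_left.1 hd (h hx) (hDr (hAD hx))
      rw [if_neg this, if_pos (hAD.trans hDr)]
      exact hr hr' hDr h1 h2
    rw [if_neg hDr] at h1 h2 ⊢
    have hAl : ¬ A ⊆ l.points := fun h => h1 (Finset.subset_inter h hAD)
    have hAr : ¬ A ⊆ r.points := fun h => h2 (Finset.subset_inter h hAD)
    rw [if_neg hAl, if_neg hAr]
    simp only [Finset.inter_assoc, Finset.inter_eq_right.2 hAD]

end SplitSet

end InteractiveClustering

namespace InteractiveClustering

/-! ### The potential and its change under one request. -/

section Potential

variable {X : Type*} [DecidableEq X]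

/-- A set of clusters that partitions the data set. -/
structure IsPartition (C : Finset (Finset X)) : Prop where
  cover : ∀ x, ∃ A ∈ C, x ∈ A
  unique : ∀ A ∈ C, ∀ B ∈ C, ∀ x, x ∈ A → x ∈ B → A = B
  nonempty : ∀ A ∈ C, A.Nonempty

theorem isPartition_parts [Fintype X] (C : Clustering X) : IsPartition C.parts where
  cover := exists_mem_parts C
  unique _ hA _ hB _ hx hy := C.eq_of_mem_parts hA hB hx hy
  nonempty _ hA := C.nonempty_of_mem_parts hA

/-- The clustering with a given set of clusters. -/
def IsPartition.toClustering [Fintype X] {C : Finset (Finset X)} (hC : IsPartition C) : Clustering X where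
  parts := C
  supIndep := by
    rw [Finset.supIndep_iff_pairwiseDisjoint]
    intro A hA B hB hAB
    exact Finset.disjoint_left.2 fun x hx hy => hAB (hC.unique A hA B hB x hx hy)
  sup_parts := by
    ext x
    simpa [Finset.mem_sup] using hC.cover x
  bot_notMem h := by simpa using hC.nonempty _ h

/-- Exchanging some clusters for a partition of their union. -/
theorem IsPartition.exchange {C M N : Finset (Finset X)} (hC : IsPartition C) (hM : M ⊆ C)
    (hN0 : ∀ A ∈ N, A.Nonempty) (hN : ∀ A ∈ N, ∀ B ∈ N, ∀ x, x ∈ A → x ∈ B → A = B)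
    (hU : ∀ x, (∃ A ∈ M, x ∈ A) ↔ ∃ A ∈ N, x ∈ A) :
    IsPartition (C \ M ∪ N) ∧ ∀ w : Finset X → ℤ,
      ∑ A ∈ C \ M ∪ N, w A = ∑ A ∈ C, w A - ∑ A ∈ M, w A + ∑ A ∈ N, w A := by
  have hcross : ∀ A ∈ C \ M, ∀ B ∈ N, ∀ x, x ∈ A → x ∉ B := by
    intro A hA B hB x hxA hxB
    obtain ⟨A', hA', hx'⟩ := (hU x).2 ⟨B, hB, hxB⟩
    obtain ⟨hAC, hAM⟩ := Finset.mem_sdiff.1 hA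
    rw [hC.unique A hAC A' (hM hA') x hxA hx'] at hAM
    exact hAM hA'
  refine ⟨⟨?_, ?_, ?_⟩, ?_⟩
  · intro x
    obtain ⟨A, hA, hx⟩ := hC.cover x
    by_cases hAM : A ∈ M
    · obtain ⟨B, hB, hxB⟩ := (hU x).1 ⟨A, hAM, hx⟩
      exact ⟨B, Finset.mem_union_right _ hB, hxB⟩
    · exact ⟨A, Finset.mem_union_left _ (Finset.mem_sdiff.2 ⟨hA, hAM⟩), hx⟩
  · intro A hA B hB x hxA hxB
    rcases Finset.mem_union.1 hA with hA | hA <;> rcases Finset.mem_union.1 hB with hB | hB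
    · exact hC.unique A (Finset.mem_sdiff.1 hA).1 B (Finset.mem_sdiff.1 hB).1 x hxA hxB
    · exact absurd hxB (hcross A hA B hB x hxA)
    · exact absurd hxA (hcross B hB A hA x hxB)
    · exact hN A hA B hB x hxA hxB
  · intro A hA
    rcases Finset.mem_union.1 hA with hA | hA
    · exact hC.nonempty A (Finset.mem_sdiff.1 hA).1
    · exact hN0 A hA
  · intro w
    have hd : Disjoint (C \ M) N := by
      refine Finset.disjoint_left.2 fun A hA hAN => ?_
      obtain ⟨x, hx⟩ := hN0 A hAN
      exact hcross A hA A hAN x hx hx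
    rw [Finset.sum_union hd, ← Finset.sum_sdiff hM]
    ring

/-- Indicator of `A` having a point in `D`. -/
def meetInd (A D : Finset X) : ℤ := if (A ∩ D).Nonempty then 1 else 0

/-- Indicator of `A` having points in both parts of `D`. -/
def mixInd (T : HTree X) (A D : Finset X) : ℤ :=
  if (A ∩ (T.splitSet D).1).Nonempty ∧ (A ∩ (T.splitSet D).2).Nonempty then 1 else 0

/-- The contribution of the cluster `A` to the potential. -/
def weight [Fintype X] (T : HTree X) (Cstar : Clustering X) (A : Finset X) : ℤ :=
  ∑ D ∈ Cstar.parts, (3 * meetInd A D + mixInd T A D) - 1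

/-- The contribution of the cluster `A` to the distance from the target. -/
def errWeight [Fintype X] (Cstar : Clustering X) (A : Finset X) : ℤ :=
  ∑ D ∈ Cstar.parts, 2 * meetInd A D - 1

theorem meetInd_nonneg (A D : Finset X) : 0 ≤ meetInd A D := by
  unfold meetInd; split_ifs <;> simp

theorem mixInd_nonneg (T : HTree X) (A D : Finset X) : 0 ≤ mixInd T A D := by
  unfold mixInd; split_ifs <;> simp

theorem meetInd_union_of_disjoint {A B D : Finset X} (h : Disjoint A D ∨ Disjoint B D) :
    meetInd (A ∪ B) D = meetInd A D + meetInd B D := by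
  unfold meetInd
  simp only [Finset.union_inter_distrib_right]
  rcases h with h | h <;> simp [Finset.disjoint_iff_inter_eq_empty.1 h]

theorem mixInd_union_of_disjoint (T : HTree X) {A B D : Finset X}
    (hD : (T.splitSet D).1 ∪ (T.splitSet D).2 = D) (h : Disjoint A D ∨ Disjoint B D) :
    mixInd T (A ∪ B) D = mixInd T A D + mixInd T B D := by
  unfold mixInd
  simp only [Finset.union_inter_distrib_right]
  have h1 : (T.splitSet D).1 ⊆ D := Finset.subset_union_left.trans hD.le
  have h2 : (T.splitSet D).2 ⊆ D := Finset.subset_union_right.trans hD.le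
  rcases h with h | h <;> simp [Finset.disjoint_iff_inter_eq_empty.1 (h.mono_right h1),
    Finset.disjoint_iff_inter_eq_empty.1 (h.mono_right h2)]

theorem meetInd_union_le (A B D : Finset X) :
    meetInd (A ∪ B) D ≤ meetInd A D + meetInd B D := by
  unfold meetInd
  simp only [Finset.union_inter_distrib_right, Finset.union_nonempty]
  split_ifs <;> simp_all

theorem meetInd_union_lt {A B D : Finset X} (hA : (A ∩ D).Nonempty) (hB : (B ∩ D).Nonempty) :
    meetInd (A ∪ B) D + 1 ≤ meetInd A D + meetInd B D := by
  unfold meetInd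
  simp only [Finset.union_inter_distrib_right, Finset.union_nonempty]
  simp [hA, hB]

/-- A union can newly straddle the halves of `D` only if both sets meet `D`; the lost incidence then
pays for it. This uses one of the three units of weight of an incidence. -/
theorem mixInd_union_le (T : HTree X) {A B D : Finset X}
    (hD : (T.splitSet D).1 ∪ (T.splitSet D).2 = D) :
    mixInd T (A ∪ B) D + meetInd (A ∪ B) D ≤
      mixInd T A D + mixInd T B D + (meetInd A D + meetInd B D) := by
  by_cases h : Disjoint A D ∨ Disjoint B D
  · rw [mixInd_union_of_disjoint T hD h, meetInd_union_of_disjoint h]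
  · push Not at h
    have h1 := Finset.not_disjoint_iff_nonempty_inter.1 h.1
    have h2 := Finset.not_disjoint_iff_nonempty_inter.1 h.2
    have h3 := meetInd_union_lt h1 h2
    have h4 : mixInd T (A ∪ B) D ≤ 1 := by unfold mixInd; split_ifs <;> simp
    linarith [mixInd_nonneg T A D, mixInd_nonneg T B D]

section

variable [Fintype X] {T : HTree X} {Cstar : Clustering X} (hT : T.IsLaminar Cstar)
  (hTu : T.points = Finset.univ)

theorem errWeight_clean {A B : Finset X}
    (h : ∀ D ∈ Cstar.parts, Disjoint A D ∨ Disjoint B D) :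
    errWeight Cstar A + errWeight Cstar B = errWeight Cstar (A ∪ B) - 1 := by
  have h1 : ∑ D ∈ Cstar.parts, 2 * meetInd (A ∪ B) D =
      ∑ D ∈ Cstar.parts, (2 * meetInd A D + 2 * meetInd B D) :=
    Finset.sum_congr rfl fun D hD => by rw [meetInd_union_of_disjoint (h D hD), mul_add]
  unfold errWeight
  rw [h1, Finset.sum_add_distrib]
  ring

theorem errWeight_of_subset {A D : Finset X} (hD : D ∈ Cstar.parts) (hAD : A ⊆ D)
    (hA : A.Nonempty) : errWeight Cstar A = 1 := by
  unfold errWeight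
  rw [Finset.sum_eq_single_of_mem D hD]
  · rw [meetInd, if_pos (by rwa [Finset.inter_eq_left.2 hAD])]; norm_num
  · intro D' hD' hne
    have : Disjoint A D' := (Cstar.disjoint hD' hD hne).symm.mono_left hAD
    simp [meetInd, Finset.disjoint_iff_inter_eq_empty.1 this]

include hT hTu

theorem splitSet_union (A : Finset X) : (T.splitSet A).1 ∪ (T.splitSet A).2 = A :=
  (hT.splitSet_parts (hTu ▸ Finset.subset_univ A)).2

/-- If no target cluster is cut, both indicators are additive, and only the constant `-1` per
cluster changes. -/
theorem weight_clean {A B : Finset X} (h : ∀ D ∈ Cstar.parts, Disjoint A D ∨ Disjoint B D) :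
    weight T Cstar A + weight T Cstar B = weight T Cstar (A ∪ B) - 1 := by
  have h1 : ∑ D ∈ Cstar.parts, (3 * meetInd (A ∪ B) D + mixInd T (A ∪ B) D) =
      ∑ D ∈ Cstar.parts, (3 * meetInd A D + mixInd T A D + (3 * meetInd B D + mixInd T B D)) :=
    Finset.sum_congr rfl fun D hD => by
      rw [meetInd_union_of_disjoint (h D hD),
        mixInd_union_of_disjoint T (splitSet_union hT hTu D) (h D hD)]
      ring
  unfold weight
  simp only [Finset.sum_add_distrib] at h1 ⊢
  linarith

/-- Of the weight 3 of the lost incidence at `D`, one unit covers a possible new straddling and one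
the disappearance of a cluster; one remains as gain. -/
theorem weight_union {A B D : Finset X} (hD : D ∈ Cstar.parts) (hA : (A ∩ D).Nonempty)
    (hB : (B ∩ D).Nonempty) :
    weight T Cstar (A ∪ B) + 1 ≤ weight T Cstar A + weight T Cstar B := by
  have h1 : ∑ D ∈ Cstar.parts, (mixInd T (A ∪ B) D + meetInd (A ∪ B) D) ≤
      ∑ D ∈ Cstar.parts, (mixInd T A D + mixInd T B D + (meetInd A D + meetInd B D)) :=
    Finset.sum_le_sum fun D _ => mixInd_union_le T (splitSet_union hT hTu D)
  have h2 : ∑ D ∈ Cstar.parts, meetInd (A ∪ B) D <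
      ∑ D ∈ Cstar.parts, (meetInd A D + meetInd B D) :=
    Finset.sum_lt_sum (fun D _ => meetInd_union_le A B D)
      ⟨D, hD, Int.lt_iff_add_one_le.2 (meetInd_union_lt hA hB)⟩
  unfold weight
  simp only [Finset.sum_add_distrib, ← Finset.mul_sum] at h1 h2 ⊢
  linarith

/-- Among pure clusters only straddling matters, so a failed merge inside `D` can gain only by
removing it. -/
theorem weight_of_subset {A D : Finset X} (hD : D ∈ Cstar.parts) (hA : A.Nonempty)
    (hAD : A ⊆ D) : weight T Cstar A = 2 + mixInd T A D := by
  unfold weight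
  rw [Finset.sum_eq_single_of_mem D hD]
  · rw [meetInd, if_pos (by rwa [Finset.inter_eq_left.2 hAD])]
    ring
  · intro D' hD' hne
    have h : Disjoint A D' := (Cstar.disjoint hD' hD hne).symm.mono_left hAD
    have h1 : (T.splitSet D').1 ⊆ D' :=
      Finset.subset_union_left.trans (splitSet_union hT hTu D').le
    simp [meetInd, mixInd, Finset.disjoint_iff_inter_eq_empty.1 h,
      Finset.disjoint_iff_inter_eq_empty.1 (h.mono_right h1)]

theorem mixInd_eq_zero_of_subset {A D : Finset X}
    (h : A ⊆ (T.splitSet D).1 ∨ A ⊆ (T.splitSet D).2) : mixInd T A D = 0 := by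
  have hd := (hT.splitSet_parts (hTu ▸ Finset.subset_univ D)).1
  unfold mixInd
  rcases h with h | h
  · simp [Finset.disjoint_iff_inter_eq_empty.1 (hd.mono_left h)]
  · simp [Finset.disjoint_iff_inter_eq_empty.1 (hd.symm.mono_left h)]

theorem subset_of_mixInd_eq_zero {A D : Finset X} (hAD : A ⊆ D) (h : mixInd T A D = 0) :
    A ⊆ (T.splitSet D).1 ∨ A ⊆ (T.splitSet D).2 := by
  rw [← splitSet_union hT hTu D] at hAD
  by_contra! hcon
  obtain ⟨x, hx, hx1⟩ := Finset.not_subset.1 hcon.1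
  obtain ⟨y, hy, hy2⟩ := Finset.not_subset.1 hcon.2
  refine absurd h ?_
  rw [mixInd, if_pos]
  · norm_num
  · exact ⟨⟨y, Finset.mem_inter.2 ⟨hy, (Finset.mem_union.1 (hAD hy)).resolve_right hy2⟩⟩,
      ⟨x, Finset.mem_inter.2 ⟨hx, (Finset.mem_union.1 (hAD hx)).resolve_left hx1⟩⟩⟩

/-- The parts of a subset of a target cluster `D` do not have points in both parts of `D`. -/
theorem mixInd_splitSet {A D : Finset X} (hAD : A ⊆ D) :
    mixInd T (T.splitSet A).1 D = 0 ∧ mixInd T (T.splitSet A).2 D = 0 := by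
  have hu := splitSet_union hT hTu A
  have h1 : (T.splitSet A).1 ⊆ A := Finset.subset_union_left.trans hu.le
  have h2 : (T.splitSet A).2 ⊆ A := Finset.subset_union_right.trans hu.le
  by_cases h : A ⊆ (T.splitSet D).1 ∨ A ⊆ (T.splitSet D).2
  · constructor <;> apply mixInd_eq_zero_of_subset hT hTu
    · exact h.imp h1.trans h1.trans
    · exact h.imp h2.trans h2.trans
  · push Not at h
    rw [hT.splitSet_of_subset (hTu ▸ Finset.subset_univ D) hAD h.1 h.2]
    exact ⟨mixInd_eq_zero_of_subset hT hTu (Or.inl Finset.inter_subset_left),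
      mixInd_eq_zero_of_subset hT hTu (Or.inr Finset.inter_subset_left)⟩

/-- An unsuccessful merge inside `D` of two sets, none of which meets both parts of `D`, takes place
inside one of the two parts. -/
theorem union_subset_of_splitSet_ne {A B D : Finset X} (hAD : A ⊆ D) (hBD : B ⊆ D)
    (hA : mixInd T A D = 0) (hB : mixInd T B D = 0)
    (hne : ({(T.splitSet (A ∪ B)).1, (T.splitSet (A ∪ B)).2} : Finset (Finset X)) ≠ {A, B}) :
    A ∪ B ⊆ (T.splitSet D).1 ∨ A ∪ B ⊆ (T.splitSet D).2 := by
  have hd := (hT.splitSet_parts (hTu ▸ Finset.subset_univ D)).1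
  by_contra! hcon
  have hs := hT.splitSet_of_subset (hTu ▸ Finset.subset_univ D) (Finset.union_subset hAD hBD)
    hcon.1 hcon.2
  have key : ∀ {N₁ N₂ A B : Finset X}, Disjoint N₁ N₂ → A ⊆ N₁ → B ⊆ N₂ →
      N₁ ∩ (A ∪ B) = A ∧ N₂ ∩ (A ∪ B) = B := by
    intro N₁ N₂ A B hd hA hB
    rw [Finset.inter_union_distrib_left, Finset.inter_union_distrib_left,
      Finset.inter_eq_right.2 hA, Finset.inter_eq_right.2 hB,
      Finset.disjoint_iff_inter_eq_empty.1 (hd.mono_right hB),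
      Finset.disjoint_iff_inter_eq_empty.1 (hd.symm.mono_right hA)]
    simp
  rcases subset_of_mixInd_eq_zero hT hTu hAD hA with h | h <;>
    rcases subset_of_mixInd_eq_zero hT hTu hBD hB with h' | h'
  · exact hcon.1 (Finset.union_subset h h')
  · obtain ⟨e1, e2⟩ := key hd h h'
    rw [hs, e1, e2] at hne
    exact hne rfl
  · obtain ⟨e1, e2⟩ := key hd h' h
    rw [Finset.union_comm] at e1 e2
    rw [hs, e1, e2, Finset.pair_comm] at hne
    exact hne rfl
  · exact hcon.2 (Finset.union_subset h h')

/-- The effect of one feasible request: the potential does not increase, and it decreases unless the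
request is a merge inside one of the two parts of a target cluster. -/
theorem respond_spec {C : Finset (Finset X)} (hC : IsPartition C) {r : Request X}
    (hr : Feasible Cstar C r) :
    IsPartition (respond T C r) ∧
      ∑ A ∈ respond T C r, weight T Cstar A ≤ ∑ A ∈ C, weight T Cstar A ∧
      (∑ A ∈ respond T C r, weight T Cstar A < ∑ A ∈ C, weight T Cstar A ∨
        ∃ M, r = Request.merge M ∧ ∃ D ∈ Cstar.parts,
          M.sup id ⊆ (T.splitSet D).1 ∨ M.sup id ⊆ (T.splitSet D).2) := by
  have hparts : ∀ U : Finset X, 1 < U.card →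
      (∀ A ∈ ({(T.splitSet U).1, (T.splitSet U).2} : Finset (Finset X)), A.Nonempty) ∧
      (∀ A ∈ ({(T.splitSet U).1, (T.splitSet U).2} : Finset (Finset X)),
        ∀ B ∈ ({(T.splitSet U).1, (T.splitSet U).2} : Finset (Finset X)),
        ∀ x, x ∈ A → x ∈ B → A = B) ∧
      (∀ x, x ∈ U ↔
        ∃ A ∈ ({(T.splitSet U).1, (T.splitSet U).2} : Finset (Finset X)), x ∈ A) ∧
      ∑ A ∈ ({(T.splitSet U).1, (T.splitSet U).2} : Finset (Finset X)), weight T Cstar A =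
        weight T Cstar (T.splitSet U).1 + weight T Cstar (T.splitSet U).2 := by
    intro U hU
    obtain ⟨n1, n2⟩ := hT.splitSet_nonempty (hTu ▸ Finset.subset_univ U) hU
    obtain ⟨hd, hu⟩ := hT.splitSet_parts (hTu ▸ Finset.subset_univ U)
    refine ⟨by simp [n1, n2], ?_, ?_, ?_⟩
    · have := Finset.disjoint_left.1 hd
      intro A hA B hB x hxA hxB
      simp only [Finset.mem_insert, Finset.mem_singleton] at hA hB
      rcases hA with rfl | rfl <;> rcases hB with rfl | rfl
      · rfl
      · exact absurd hxB (this hxA)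
      · exact absurd hxA (this hxB)
      · rfl
    · intro x
      conv_lhs => rw [← hu]
      simp
    · rw [Finset.sum_pair]
      intro h
      rw [h, disjoint_self] at hd
      rw [hd] at n2
      simp at n2
  cases r with
  | split A =>
    obtain ⟨hA, D, hD, D', hD', hne, hAD, hAD'⟩ := hr
    have himp : ∀ E ∈ Cstar.parts, ¬ A ⊆ E := by
      intro E hE hAE
      have : ∀ F ∈ Cstar.parts, (A ∩ F).Nonempty → F = E := by
        intro F hF ⟨x, hx⟩
        obtain ⟨h1, h2⟩ := Finset.mem_inter.1 hx
        exact Cstar.eq_of_mem_parts hF hE h2 (hAE h1)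
      exact hne ((this D hD hAD).trans (this D' hD' hAD').symm)
    have hcard : 1 < A.card := by
      obtain ⟨x, hx⟩ := hAD
      obtain ⟨y, hy⟩ := hAD'
      obtain ⟨h1, h2⟩ := Finset.mem_inter.1 hx
      obtain ⟨h3, h4⟩ := Finset.mem_inter.1 hy
      refine Finset.one_lt_card.2 ⟨x, h1, y, h3, ?_⟩
      rintro rfl
      exact hne (Cstar.eq_of_mem_parts hD hD' h2 h4)
    obtain ⟨p1, p2, p3, p4⟩ := hparts A hcard
    have hex := hC.exchange (M := {A}) (Finset.singleton_subset_iff.2 hA) p1 p2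
      (fun x => by rw [← p3]; simp)
    have hcl := weight_clean hT hTu fun D hD =>
      hT.splitSet_clean (hTu ▸ Finset.subset_univ A) hcard himp hD
    rw [splitSet_union hT hTu] at hcl
    have heq : respond T C (Request.split A) =
        C \ {A} ∪ {(T.splitSet A).1, (T.splitSet A).2} := by
      simp only [respond, splitProc, Finset.sdiff_singleton_eq_erase]
    rw [heq]
    have hs := hex.2 (weight T Cstar)
    rw [p4, Finset.sum_singleton] at hs
    exact ⟨hex.1, by linarith, Or.inl (by linarith)⟩
  | merge M =>
    obtain ⟨hMC, hM2, D, hD, hMD⟩ := hr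
    obtain ⟨A, B, hAB, rfl⟩ := Finset.card_eq_two.1 hM2
    have hsup : ({A, B} : Finset (Finset X)).sup id = A ∪ B := by simp
    have hA : A ∈ C := hMC (by simp)
    have hB : B ∈ C := hMC (by simp)
    have hAD := hMD A (by simp)
    have hBD := hMD B (by simp)
    have hdAB : Disjoint A B :=
      Finset.disjoint_left.2 fun x hx hy => hAB (hC.unique A hA B hB x hx hy)
    have hw := weight_union hT hTu hD hAD hBD
    have hsumM : ∑ E ∈ ({A, B} : Finset (Finset X)), weight T Cstar E =
        weight T Cstar A + weight T Cstar B := Finset.sum_pair hAB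
    have hcard : 1 < (A ∪ B).card := by
      rw [Finset.card_union_of_disjoint hdAB]
      have := (hC.nonempty A hA).card_pos
      have := (hC.nonempty B hB).card_pos
      omega
    simp only [respond, mergeProc, hsup]
    split_ifs with hsucc
    · have hex := hC.exchange (N := {A ∪ B}) hMC
        (by simp [(hC.nonempty A hA).mono Finset.subset_union_left])
        (by simp) (fun x => by simp)
      have hs := hex.2 (weight T Cstar)
      rw [hsumM, Finset.sum_singleton] at hs
      exact ⟨hex.1, by linarith, Or.inl (by linarith)⟩
    · obtain ⟨p1, p2, p3, p4⟩ := hparts _ hcard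
      have hex := hC.exchange hMC p1 p2 (fun x => by rw [← p3]; simp)
      have hs := hex.2 (weight T Cstar)
      rw [hsumM, p4] at hs
      -- If the union is impure, a failed merge acts as a union followed by a clean split, and both
      -- gain.
      by_cases himp : ∀ E ∈ Cstar.parts, ¬ A ∪ B ⊆ E
      · have hcl := weight_clean hT hTu fun D hD =>
          hT.splitSet_clean (hTu ▸ Finset.subset_univ (A ∪ B)) hcard himp hD
        rw [splitSet_union hT hTu] at hcl
        exact ⟨hex.1, by linarith, Or.inl (by linarith)⟩
      · push Not at himp
        obtain ⟨E, hE, hUE⟩ := himp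
        obtain ⟨n1, n2⟩ := hT.splitSet_nonempty (hTu ▸ Finset.subset_univ (A ∪ B)) hcard
        have hu := splitSet_union hT hTu (A ∪ B)
        obtain ⟨z1, z2⟩ := mixInd_splitSet hT hTu hUE
        have hAE := Finset.subset_union_left.trans hUE
        have hBE := Finset.subset_union_right.trans hUE
        rw [weight_of_subset hT hTu hE (hC.nonempty A hA) hAE,
          weight_of_subset hT hTu hE (hC.nonempty B hB) hBE,
          weight_of_subset hT hTu hE n1 (Finset.subset_union_left.trans (hu.le.trans hUE)),
          weight_of_subset hT hTu hE n2 (Finset.subset_union_right.trans (hu.le.trans hUE)),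
          z1, z2] at hs
        have hA0 := mixInd_nonneg T A E
        have hB0 := mixInd_nonneg T B E
        refine ⟨hex.1, by linarith, ?_⟩
        -- After the failed merge nothing straddles the halves of `E`, so there is a gain unless
        -- neither `A` nor `B` did before.
        by_cases hz : mixInd T A E = 0 ∧ mixInd T B E = 0
        · exact Or.inr ⟨_, rfl, E, hE, by
            rw [hsup]; exact union_subset_of_splitSet_ne hT hTu hAE hBE hz.1 hz.2 hsucc⟩
        · left
          have : 0 < mixInd T A E + mixInd T B E := by
            by_contra hcon
            exact hz ⟨by linarith, by linarith⟩
          linarith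

end

end Potential

end InteractiveClustering

namespace InteractiveClustering

/-! ### Size of the potential, and the ratio of bad to good merges. -/

section Counting

variable {X : Type*} [DecidableEq X] [Fintype X]

/-- The potential of a set of clusters. -/
def potential (T : HTree X) (Cstar : Clustering X) (C : Finset (Finset X)) : ℤ :=
  ∑ A ∈ C, weight T Cstar A - ∑ D ∈ Cstar.parts, (2 + mixInd T D D)

variable {T : HTree X} {Cstar : Clustering X} (hT : T.IsLaminar Cstar)
  (hTu : T.points = Finset.univ)

theorem card_le_sum_meetInd {C : Finset (Finset X)} (hC : IsPartition C) :
    (C.card : ℤ) ≤ ∑ D ∈ Cstar.parts, ∑ A ∈ C, meetInd A D := by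
  rw [Finset.sum_comm, Finset.card_eq_sum_ones]
  push_cast
  refine Finset.sum_le_sum fun A hA => ?_
  obtain ⟨x, hx⟩ := hC.nonempty A hA
  obtain ⟨D, hD, hxD⟩ := exists_mem_parts Cstar x
  refine le_trans (le_of_eq ?_) (Finset.single_le_sum (fun D _ => meetInd_nonneg A D) hD)
  rw [meetInd, if_pos ⟨x, Finset.mem_inter.2 ⟨hx, hxD⟩⟩]

theorem one_le_sum_meetInd {C : Finset (Finset X)} (hC : IsPartition C) {D : Finset X}
    (hD : D ∈ Cstar.parts) : 1 ≤ ∑ A ∈ C, meetInd A D := by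
  obtain ⟨x, hx⟩ := Cstar.nonempty_of_mem_parts hD
  obtain ⟨A, hA, hxA⟩ := hC.cover x
  refine le_trans (le_of_eq ?_) (Finset.single_le_sum (fun A _ => meetInd_nonneg A D) hA)
  rw [meetInd, if_pos ⟨x, Finset.mem_inter.2 ⟨hxA, hx⟩⟩]

theorem sum_errWeight (C : Finset (Finset X)) :
    ∑ A ∈ C, errWeight Cstar A = 2 * ∑ D ∈ Cstar.parts, ∑ A ∈ C, meetInd A D - C.card := by
  unfold errWeight
  rw [Finset.sum_sub_distrib, Finset.sum_comm]
  simp [Finset.mul_sum]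

include hT hTu

theorem mixInd_le_meetInd (A D : Finset X) : mixInd T A D ≤ meetInd A D := by
  by_cases h : (A ∩ D).Nonempty
  · rw [meetInd, if_pos h, mixInd]
    split_ifs <;> simp
  · have h1 : (T.splitSet D).1 ⊆ D :=
      Finset.subset_union_left.trans (splitSet_union hT hTu D).le
    rw [meetInd, if_neg h, mixInd, if_neg]
    exact fun h' => h (h'.1.mono (Finset.inter_subset_inter_left h1))

/-- If a single cluster meets `D`, it contains `D` and both bounds are equalities. Otherwise at
least two clusters meet `D`, and the crude bounds 0 and the number of incidences for the straddling
sum suffice. -/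
theorem sum_mixInd_bounds {C : Finset (Finset X)} (hC : IsPartition C) {D : Finset X}
    (hD : D ∈ Cstar.parts) :
    1 + mixInd T D D ≤ ∑ A ∈ C, meetInd A D + ∑ A ∈ C, mixInd T A D ∧
    ∑ A ∈ C, meetInd A D + ∑ A ∈ C, mixInd T A D ≤
      1 + mixInd T D D + 3 * (∑ A ∈ C, meetInd A D - 1) := by
  obtain ⟨x, hx⟩ := Cstar.nonempty_of_mem_parts hD
  obtain ⟨A, hA, hxA⟩ := hC.cover x
  have hmA : meetInd A D = 1 := by rw [meetInd, if_pos ⟨x, Finset.mem_inter.2 ⟨hxA, hx⟩⟩]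
  by_cases h : ∀ B ∈ C, (B ∩ D).Nonempty → B = A
  · have hDA : D ⊆ A := by
      intro y hy
      obtain ⟨B, hB, hyB⟩ := hC.cover y
      rw [← h B hB ⟨y, Finset.mem_inter.2 ⟨hyB, hy⟩⟩]
      exact hyB
    have hm0 : ∀ B ∈ C, B ≠ A → meetInd B D = 0 := fun B hB hne => by
      rw [meetInd, if_neg fun h' => hne (h B hB h')]
    have e1 : ∑ A ∈ C, meetInd A D = 1 := by rw [Finset.sum_eq_single_of_mem A hA hm0, hmA]
    have e2 : ∑ A ∈ C, mixInd T A D = mixInd T D D := by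
      rw [Finset.sum_eq_single_of_mem A hA]
      · have hu := splitSet_union hT hTu D
        have h1 : (T.splitSet D).1 ⊆ D := Finset.subset_union_left.trans hu.le
        have h2 : (T.splitSet D).2 ⊆ D := Finset.subset_union_right.trans hu.le
        unfold mixInd
        rw [Finset.inter_eq_right.2 h1, Finset.inter_eq_right.2 h2,
          Finset.inter_eq_right.2 (h1.trans hDA), Finset.inter_eq_right.2 (h2.trans hDA)]
      · intro B hB hne
        refine le_antisymm ?_ (mixInd_nonneg T B D)
        rw [← hm0 B hB hne]
        exact mixInd_le_meetInd hT hTu B D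
    rw [e1, e2]
    constructor <;> linarith
  · push Not at h
    obtain ⟨B, hB, hBD, hne⟩ := h
    have h2 : 2 ≤ ∑ A ∈ C, meetInd A D := by
      have hmB : meetInd B D = 1 := by rw [meetInd, if_pos hBD]
      have hsub : ({A, B} : Finset (Finset X)) ⊆ C := by
        simp [Finset.insert_subset_iff, hA, hB]
      refine le_trans ?_ (Finset.sum_le_sum_of_subset_of_nonneg hsub
        fun E _ _ => meetInd_nonneg E D)
      rw [Finset.sum_pair hne.symm, hmA, hmB]
      norm_num
    have h3 : ∑ A ∈ C, mixInd T A D ≤ ∑ A ∈ C, meetInd A D :=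
      Finset.sum_le_sum fun E _ => mixInd_le_meetInd hT hTu E D
    have h4 : 0 ≤ ∑ A ∈ C, mixInd T A D := Finset.sum_nonneg fun E _ => mixInd_nonneg T E D
    have h5 : mixInd T D D ≤ 1 := by unfold mixInd; split_ifs <;> simp
    have h6 := mixInd_nonneg T D D
    constructor <;> linarith

/-- The potential in terms of nonnegative quantities. -/
theorem potential_bounds {C : Finset (Finset X)} (hC : IsPartition C) :
    ∑ D ∈ Cstar.parts, (∑ A ∈ C, meetInd A D - 1) ≤ potential T Cstar C ∧
    potential T Cstar C ≤ 4 * (∑ A ∈ C, errWeight Cstar A - Cstar.parts.card) := by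
  have e0 : ∑ A ∈ C, weight T Cstar A = 3 * ∑ D ∈ Cstar.parts, ∑ A ∈ C, meetInd A D +
      ∑ D ∈ Cstar.parts, ∑ A ∈ C, mixInd T A D - C.card := by
    unfold weight
    rw [Finset.sum_sub_distrib, Finset.sum_comm]
    simp [Finset.mul_sum, Finset.sum_add_distrib]
  have e1 : ∑ D ∈ Cstar.parts, (2 + mixInd T D D) =
      2 * Cstar.parts.card + ∑ D ∈ Cstar.parts, mixInd T D D := by
    rw [Finset.sum_add_distrib, Finset.sum_const, nsmul_eq_mul, mul_comm]
  have hc := card_le_sum_meetInd (Cstar := Cstar) hC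
  have hl := Finset.sum_le_sum fun D hD => (sum_mixInd_bounds hT hTu hC (D := D) hD).1
  have hr := Finset.sum_le_sum fun D hD => (sum_mixInd_bounds hT hTu hC (D := D) hD).2
  rw [sum_errWeight, potential, e0, e1]
  simp only [Finset.sum_add_distrib, Finset.sum_sub_distrib, Finset.sum_const, nsmul_eq_mul,
    ← Finset.mul_sum, mul_one] at hl hr ⊢
  constructor <;> linarith

/-- The potential dominates the total number of excess incidences, hence the excess at each single
target cluster. -/
theorem card_meet_le {C : Finset (Finset X)} (hC : IsPartition C) {D : Finset X}
    (hD : D ∈ Cstar.parts) :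
    ((C.filter fun A => (A ∩ D).Nonempty).card : ℤ) ≤ potential T Cstar C + 1 := by
  have h1 := (potential_bounds hT hTu hC).1
  have h2 := Finset.single_le_sum (f := fun D => ∑ A ∈ C, meetInd A D - 1)
    (fun D hD => sub_nonneg.2 (one_le_sum_meetInd (Cstar := Cstar) hC hD)) hD
  have h3 : ((C.filter fun A => (A ∩ D).Nonempty).card : ℤ) = ∑ A ∈ C, meetInd A D := by
    simp [meetInd]
  linarith

/-- Most merges are not far from a merge that decreases the potential: the merges inside one part
of a target cluster are outnumbered by the others up to a factor `2 * N`. -/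
theorem card_merge_le {C : Finset (Finset X)} (hC : IsPartition C) {N : ℕ}
    (hN : ∀ D ∈ Cstar.parts, (C.filter fun A => (A ∩ D).Nonempty).card ≤ N)
    {bad good : Finset (Finset (Finset X))}
    (hbad : ∀ M ∈ bad, FeasibleMerge Cstar C M ∧ ∃ D ∈ Cstar.parts,
      M.sup id ⊆ (T.splitSet D).1 ∨ M.sup id ⊆ (T.splitSet D).2)
    (hgood : ∀ M, FeasibleMerge Cstar C M → (¬ ∃ D ∈ Cstar.parts,
      M.sup id ⊆ (T.splitSet D).1 ∨ M.sup id ⊆ (T.splitSet D).2) → M ∈ good) :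
    bad.card ≤ N * (2 * good.card) := by
  classical
  have key : ∀ M ∈ bad, ∃ A B Z D : Finset X, D ∈ Cstar.parts ∧ A ∈ C ∧ B ∈ C ∧ Z ∈ C ∧
      A.Nonempty ∧ A ⊆ D ∧ (B ∩ D).Nonempty ∧ M = {A, B} ∧ A ≠ Z ∧ {A, Z} ∈ good := by
    intro M hM
    obtain ⟨⟨hMC, hM2, -⟩, D, hD, hhalf⟩ := hbad M hM
    obtain ⟨A, B, hAB, rfl⟩ := Finset.card_eq_two.1 hM2
    have hA : A ∈ C := hMC (by simp)
    have hB : B ∈ C := hMC (by simp)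
    have hAn := hC.nonempty A hA
    have hBn := hC.nonempty B hB
    obtain ⟨hd, hu⟩ := hT.splitSet_parts (hTu ▸ Finset.subset_univ D)
    have h1 : (T.splitSet D).1 ⊆ D := Finset.subset_union_left.trans hu.le
    have h2 : (T.splitSet D).2 ⊆ D := Finset.subset_union_right.trans hu.le
    have hsup : ({A, B} : Finset (Finset X)).sup id = A ∪ B := by simp
    rw [hsup] at hhalf
    have hUD : A ∪ B ⊆ D := by
      rcases hhalf with h | h
      exacts [h.trans h1, h.trans h2]
    have hAD : A ⊆ D := Finset.subset_union_left.trans hUD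
    have hBD : B ⊆ D := Finset.subset_union_right.trans hUD
    have hcard : 1 < D.card := by
      refine lt_of_lt_of_le ?_ (Finset.card_le_card hUD)
      rw [Finset.card_union_of_disjoint
        (Finset.disjoint_left.2 fun x hx hy => hAB (hC.unique A hA B hB x hx hy))]
      have := hAn.card_pos
      have := hBn.card_pos
      omega
    obtain ⟨n1, n2⟩ := hT.splitSet_nonempty (hTu ▸ Finset.subset_univ D) hcard
    -- The point `y` is taken from the half of `D` that does not contain `A`; the cluster `Z`
    -- through `y` makes `{A, Z}` a good merge.
    have hy : ∃ y ∈ D, ∀ E ⊆ D, y ∈ E → (E ⊆ (T.splitSet D).1 ∨ E ⊆ (T.splitSet D).2) →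
        Disjoint A E := by
      rcases hhalf with h | h
      · obtain ⟨y, hy⟩ := n2
        refine ⟨y, h2 hy, fun E _ hyE hE => ?_⟩
        have hE2 := hE.resolve_left fun h' => Finset.disjoint_left.1 hd (h' hyE) hy
        exact hd.mono (Finset.subset_union_left.trans h) hE2
      · obtain ⟨y, hy⟩ := n1
        refine ⟨y, h1 hy, fun E _ hyE hE => ?_⟩
        have hE1 := hE.resolve_right fun h' => Finset.disjoint_left.1 hd hy (h' hyE)
        exact (hd.mono hE1 (Finset.subset_union_left.trans h)).symm
    obtain ⟨y, hyD, hy⟩ := hy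
    obtain ⟨Z, hZ, hyZ⟩ := hC.cover y
    have hnot : ∀ D' ∈ Cstar.parts, ¬ (A ∪ Z ⊆ (T.splitSet D').1 ∨
        A ∪ Z ⊆ (T.splitSet D').2) := by
      intro D' hD' h
      obtain ⟨x, hx⟩ := hAn
      have hu' := splitSet_union hT hTu D'
      have hAZ : A ∪ Z ⊆ D' := by
        rcases h with h | h
        · exact h.trans (Finset.subset_union_left.trans hu'.le)
        · exact h.trans (Finset.subset_union_right.trans hu'.le)
      obtain rfl := Cstar.eq_of_mem_parts hD hD' (hAD hx) (hAZ (Finset.mem_union_left _ hx))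
      have := hy (A ∪ Z) hAZ (Finset.mem_union_right _ hyZ) h
      exact Finset.disjoint_left.1 this hx (Finset.mem_union_left _ hx)
    have hAZ : A ≠ Z := by
      rintro rfl
      apply hnot D hD
      rw [Finset.union_self]
      exact hhalf.imp Finset.subset_union_left.trans Finset.subset_union_left.trans
    refine ⟨A, B, Z, D, hD, hA, hB, hZ, hAn, hAD, ?_, rfl, hAZ, hgood _ ⟨?_, ?_, D, hD, ?_⟩ ?_⟩
    · rwa [Finset.inter_eq_left.2 hBD]
    · simp [Finset.insert_subset_iff, hA, hZ]
    · exact Finset.card_pair hAZ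
    · intro E hE
      simp only [Finset.mem_insert, Finset.mem_singleton] at hE
      rcases hE with rfl | rfl
      · rwa [Finset.inter_eq_left.2 hAD]
      · exact ⟨y, Finset.mem_inter.2 ⟨hyZ, hyD⟩⟩
    · rintro ⟨D', hD', h⟩
      refine hnot D' hD' ?_
      simpa using h
  choose! A B Z D hD hA hB hZ hAn hAD hBD hM hAZ hg using key
  -- Ordered pairs remember which member is the pure cluster `A`. This costs the factor 2.
  set t : Finset (Finset X × Finset X) :=
    (C ×ˢ C).filter fun p => p.1 ≠ p.2 ∧ ({p.1, p.2} : Finset (Finset X)) ∈ good with ht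
  have ht2 : t.card ≤ 2 * good.card := by
    refine Finset.card_le_mul_card_image_of_maps_to (f := fun p => {p.1, p.2})
      (fun p hp => (Finset.mem_filter.1 hp).2.2) 2 ?_
    intro g _
    rcases (t.filter fun p => ({p.1, p.2} : Finset (Finset X)) = g).eq_empty_or_nonempty with
      h | ⟨⟨a, b⟩, hab⟩
    · rw [h]; simp
    · obtain ⟨hab1, rfl⟩ := Finset.mem_filter.1 hab
      refine le_trans (Finset.card_le_card (t := {(a, b), (b, a)}) ?_) Finset.card_le_two
      rintro ⟨c, d⟩ hcd
      obtain ⟨hcd1, hcd2⟩ := Finset.mem_filter.1 hcd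
      have hne := (Finset.mem_filter.1 hcd1).2.1
      simp only at hcd2 hne
      have hc : c ∈ ({a, b} : Finset (Finset X)) := hcd2 ▸ by simp
      have hd : d ∈ ({a, b} : Finset (Finset X)) := hcd2 ▸ by simp
      simp only [Finset.mem_insert, Finset.mem_singleton, Prod.mk.injEq] at hc hd ⊢
      rcases hc with rfl | rfl <;> rcases hd with rfl | rfl <;>
        first | exact absurd rfl hne | simp
  refine le_trans (Finset.card_le_mul_card_image_of_maps_to (f := fun M => (A M, Z M)) (t := t)
    ?_ N ?_) (Nat.mul_le_mul_left N ht2)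
  · intro M hMb
    exact Finset.mem_filter.2 ⟨Finset.mem_product.2 ⟨hA M hMb, hZ M hMb⟩, hAZ M hMb, hg M hMb⟩
  · rintro ⟨a, z⟩ -
    rcases (bad.filter fun M => (A M, Z M) = (a, z)).eq_empty_or_nonempty with h | ⟨M₀, hM₀⟩
    · rw [h]; simp
    · obtain ⟨hM₀b, hM₀a⟩ := Finset.mem_filter.1 hM₀
      refine le_trans (Finset.card_le_card (t := (C.filter fun B => (B ∩ D M₀).Nonempty).image
        fun B => {a, B}) ?_) (Finset.card_image_le.trans (hN _ (hD M₀ hM₀b)))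
      intro M hM'
      obtain ⟨hMb, hMa⟩ := Finset.mem_filter.1 hM'
      have e0 : A M₀ = a := congrArg Prod.fst hM₀a
      have e1 : A M = a := congrArg Prod.fst hMa
      obtain ⟨x, hx⟩ := hAn M hMb
      -- Both target clusters contain the nonempty set `a`, so they coincide. A bad merge charged to
      -- `(a, z)` is then determined by its second cluster, which meets this common target cluster.
      have hDD : D M = D M₀ := Cstar.eq_of_mem_parts (hD M hMb) (hD M₀ hM₀b) (hAD M hMb hx)
        (hAD M₀ hM₀b (by rwa [e0, ← e1]))
      refine Finset.mem_image.2 ⟨B M, Finset.mem_filter.2 ⟨hB M hMb, ?_⟩, ?_⟩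
      · rw [← hDD]
        exact hBD M hMb
      · rw [← e1]
        exact (hM M hMb).symm

end Counting

end InteractiveClustering

namespace InteractiveClustering

/-! ### Natural errors dominate the distance to the target. -/

section NaturalError

variable {X : Type*} [DecidableEq X] [Fintype X] {Cstar : Clustering X}

/-- A clustering other than the target can be improved by cutting a cluster along a target cluster
or by joining two parts of a target cluster. -/
theorem IsPartition.exists_improvement {C : Finset (Finset X)} (hC : IsPartition C)
    (hne : C ≠ Cstar.parts) :
    (∃ A ∈ C, ∃ D ∈ Cstar.parts, (A ∩ D).Nonempty ∧ (A \ D).Nonempty) ∨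
    ∃ A ∈ C, ∃ B ∈ C, A ≠ B ∧ ∃ D ∈ Cstar.parts, A ⊆ D ∧ B ⊆ D := by
  by_contra! hcon
  obtain ⟨h1, h2⟩ := hcon
  have hsub : ∀ A ∈ C, ∀ D ∈ Cstar.parts, ∀ x ∈ A, x ∈ D → A ⊆ D := fun A hA D hD x hx hxD =>
    Finset.sdiff_eq_empty_iff_subset.1 (h1 A hA D hD ⟨x, Finset.mem_inter.2 ⟨hx, hxD⟩⟩)
  have hmem : ∀ A ∈ C, A ∈ Cstar.parts := by
    intro A hA
    obtain ⟨x, hx⟩ := hC.nonempty A hA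
    obtain ⟨D, hD, hxD⟩ := exists_mem_parts Cstar x
    have hAD := hsub A hA D hD x hx hxD
    have hDA : D ⊆ A := by
      intro y hy
      obtain ⟨B, hB, hyB⟩ := hC.cover y
      by_cases hAB : A = B
      · rwa [hAB]
      · exact absurd (hsub B hB D hD y hyB hy) (h2 A hA B hB hAB D hD hAD)
    rwa [hAD.antisymm hDA]
  refine hne (Finset.Subset.antisymm hmem fun D hD => ?_)
  obtain ⟨x, hx⟩ := Cstar.nonempty_of_mem_parts hD
  obtain ⟨A, hA, hxA⟩ := hC.cover x
  rwa [← Cstar.eq_of_mem_parts (hmem A hA) hD hxA hx]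

/-- Each improving edit lowers the total `errWeight` by one, while the integer error drops by at
least one. -/
theorem IsNaturalError.exists_lt {γ : Clustering X → Clustering X → ℤ} (hγ : IsNaturalError γ)
    {C : Clustering X} (hne : C.parts ≠ Cstar.parts) :
    ∃ C' : Clustering X, γ C' Cstar < γ C Cstar ∧
      ∑ A ∈ C.parts, errWeight Cstar A ≤ ∑ A ∈ C'.parts, errWeight Cstar A + 1 := by
  have hC := isPartition_parts C
  rcases hC.exists_improvement hne with ⟨A, hA, D, hD, h1, h2⟩ | ⟨A, hA, B, hB, hAB, D, hD, h1, h2⟩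
  · have hdisj : Disjoint (A ∩ D) (A \ D) := Finset.disjoint_left.2 fun x hx hy =>
      (Finset.mem_sdiff.1 hy).2 (Finset.mem_inter.1 hx).2
    have hpair : A ∩ D ≠ A \ D := by
      intro h
      rw [h, disjoint_self] at hdisj
      rw [hdisj] at h2
      simp at h2
    have hex := hC.exchange (M := {A}) (N := {A ∩ D, A \ D})
      (Finset.singleton_subset_iff.2 hA) (by simp [h1, h2]) (by
        have := Finset.disjoint_left.1 hdisj
        intro E hE F hF x hxE hxF
        simp only [Finset.mem_insert, Finset.mem_singleton] at hE hF
        rcases hE with rfl | rfl <;> rcases hF with rfl | rfl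
        · rfl
        · exact absurd hxF (this hxE)
        · exact absurd hxE (this hxF)
        · rfl) (fun x => by
        by_cases hx : x ∈ D <;> simp [hx])
    refine ⟨hex.1.toClustering, hγ.split_lt Cstar C _ A hA D hD h1 h2 ?_, ?_⟩
    · rw [← Finset.sdiff_singleton_eq_erase]
      rfl
    · have hs := hex.2 (errWeight Cstar)
      have hcl := errWeight_clean (Cstar := Cstar) (A := A ∩ D) (B := A \ D) fun E hE => by
        by_cases h : D = E
        · exact Or.inr (h ▸ Finset.sdiff_disjoint)
        · exact Or.inl ((Cstar.disjoint hD hE h).mono_left Finset.inter_subset_right)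
      rw [Finset.union_comm, Finset.sdiff_union_inter] at hcl
      rw [Finset.sum_singleton, Finset.sum_pair hpair] at hs
      change _ ≤ ∑ A ∈ C.parts \ {A} ∪ {A ∩ D, A \ D}, errWeight Cstar A + 1
      linarith
  · have hex := hC.exchange (M := {A, B}) (N := {A ∪ B})
      (by simp [Finset.insert_subset_iff, hA, hB])
      (by simp [(hC.nonempty A hA).mono Finset.subset_union_left]) (by simp) (by simp)
    refine ⟨hex.1.toClustering, hγ.merge_lt Cstar C _ A hA B hB hAB ⟨D, hD, h1, h2⟩ rfl, ?_⟩
    have hs := hex.2 (errWeight Cstar)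
    rw [Finset.sum_singleton, Finset.sum_pair hAB,
      errWeight_of_subset hD h1 (hC.nonempty A hA), errWeight_of_subset hD h2 (hC.nonempty B hB),
      errWeight_of_subset hD (Finset.union_subset h1 h2)
        ((hC.nonempty A hA).mono Finset.subset_union_left)] at hs
    change _ ≤ ∑ A ∈ C.parts \ {A, B} ∪ {A ∪ B}, errWeight Cstar A + 1
    linarith

/-- Strong induction on the error along improving edits; at the target every cluster has `errWeight`
1, so the left side vanishes there. -/
theorem IsNaturalError.sum_errWeight_le {γ : Clustering X → Clustering X → ℤ}
    (hγ : IsNaturalError γ) (C : Clustering X) :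
    ∑ A ∈ C.parts, errWeight Cstar A - Cstar.parts.card ≤ γ C Cstar := by
  induction hn : (γ C Cstar).toNat using Nat.strong_induction_on generalizing C with
  | _ n ih =>
    have h0 := hγ.nonneg C Cstar
    by_cases hne : C.parts = Cstar.parts
    · rw [hne, Finset.sum_congr rfl fun D hD =>
        errWeight_of_subset hD subset_rfl (Cstar.nonempty_of_mem_parts hD)]
      simpa using h0
    · obtain ⟨C', hlt, hle⟩ := hγ.exists_lt hne
      have h0' := hγ.nonneg C' Cstar
      have := ih _ (by omega) C' rfl
      linarith

end NaturalError

/-! ### Means under a `PMF` and the one-round contraction. -/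

section Probability

theorem tsum_bind_mul {α β : Type*} (p : PMF α) (q : α → PMF β) (f : β → ENNReal) :
    ∑' b, (p.bind q) b * f b = ∑' a, p a * ∑' b, q a b * f b := by
  simp only [PMF.bind_apply, ← ENNReal.tsum_mul_right, ← ENNReal.tsum_mul_left]
  rw [ENNReal.tsum_comm]
  simp only [mul_assoc]

theorem tsum_pure_mul {α : Type*} (a : α) (f : α → ENNReal) :
    ∑' b, (PMF.pure a) b * f b = f a := by
  rw [tsum_eq_single a]
  · simp
  · intro b hb
    simp [hb]

theorem tsum_map_mul {α β : Type*} (p : PMF α) (g : α → β) (f : β → ENNReal) :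
    ∑' b, (p.map g) b * f b = ∑' a, p a * f (g a) := by
  rw [← PMF.bind_pure_comp, tsum_bind_mul]
  simp only [Function.comp, tsum_pure_mul]

/-- If `f ≤ a` and even `f ≤ a / 2` outside a set `s` whose mass is at most `K` times the mass of
the disjoint set `t`, then the mean of `f` is smaller than `a` by a constant factor. -/
theorem tsum_mul_le_of_half {α : Type*} [DecidableEq α] (p : PMF α) {s t : Finset α}
    (hst : Disjoint s t)
    {K : ℕ} (hK : ∑ x ∈ s, p x ≤ K * ∑ x ∈ t, p x) {f : α → ENNReal} {a : ENNReal}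
    (h1 : ∀ x ∈ p.support, f x ≤ a) (h2 : ∀ x ∈ p.support, x ∉ s → f x ≤ a / 2) :
    ∑' x, p x * f x ≤ ENNReal.ofReal (1 - 1 / (2 * (K + 1))) * a := by
  set b := ∑ x ∈ s, p x with hb
  have hb1 : b + ∑ x ∈ t, p x ≤ 1 := by
    rw [hb, ← Finset.sum_union hst, ← p.tsum_coe]
    exact ENNReal.sum_le_tsum _
  have hbK : b * (K + 1) ≤ K := by
    calc b * (K + 1) = K * b + b := by ring
      _ ≤ K * b + K * ∑ x ∈ t, p x := by gcongr
      _ = K * (b + ∑ x ∈ t, p x) := by ring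
      _ ≤ K * 1 := by gcongr
      _ = K := mul_one _
  -- Every outcome contributes half of `a`, and those in `s` another half; the mass `b` of `s` is at
  -- most `K / (K + 1)`.
  have hsum : ∑' x, p x * f x ≤ (2⁻¹ + b * 2⁻¹) * a := by
    calc ∑' x, p x * f x ≤ ∑' x, (p x * 2⁻¹ + if x ∈ s then p x * 2⁻¹ else 0) * a := by
          refine ENNReal.tsum_le_tsum fun x => ?_
          by_cases hx : p x = 0
          · simp [hx]
          have hx' : x ∈ p.support := (p.mem_support_iff x).2 hx
          by_cases hxs : x ∈ s
          · rw [if_pos hxs, ← mul_add, ENNReal.inv_two_add_inv_two, mul_one]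
            gcongr
            exact h1 x hx'
          · rw [if_neg hxs, add_zero, mul_assoc]
            gcongr
            rw [mul_comm, ← div_eq_mul_inv]
            exact h2 x hx' hxs
      _ = _ := by
          rw [ENNReal.tsum_mul_right, ENNReal.tsum_add, ENNReal.tsum_mul_right, p.tsum_coe,
            one_mul, tsum_eq_sum (s := s) fun x hx => if_neg hx, hb, Finset.sum_mul]
          congr 2
          exact Finset.sum_congr rfl fun x hx => if_pos hx
  refine hsum.trans ?_
  gcongr
  have hbtop : b ≠ ⊤ := ne_top_of_le_ne_top ENNReal.one_ne_top (le_self_add.trans hb1)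
  have hbr : b.toReal * (K + 1) ≤ K := by
    have := ENNReal.toReal_mono (ENNReal.natCast_ne_top K) hbK
    rw [ENNReal.toReal_mul, ENNReal.toReal_add (ENNReal.natCast_ne_top K) ENNReal.one_ne_top] at this
    simpa using this
  rw [ENNReal.le_ofReal_iff_toReal_le]
  · rw [ENNReal.toReal_add (by simp) (ENNReal.mul_ne_top hbtop (by simp)), ENNReal.toReal_mul]
    have hK1 : (0 : ℝ) < K + 1 := by positivity
    have : b.toReal ≤ K / (K + 1) := (le_div_iff₀ hK1).2 hbr
    have e : (1 : ℝ) - 1 / (2 * (K + 1)) = 2⁻¹ + K / (K + 1) * 2⁻¹ := by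
      field_simp
      ring
    rw [e]
    simp only [ENNReal.toReal_inv, ENNReal.toReal_ofNat]
    linarith
  · exact ENNReal.add_ne_top.2 ⟨by simp, ENNReal.mul_ne_top hbtop (by simp)⟩
  · rw [sub_nonneg, div_le_one (by positivity)]
    have : (0 : ℝ) ≤ K := by positivity
    linarith

end Probability

end InteractiveClustering

namespace InteractiveClustering

/-! ### The exponential potential along the interaction. -/

section Interaction

variable {X : Type*} [DecidableEq X] [Fintype X] {T : HTree X} {Cstar C₀ : Clustering X}
  (hT : T.IsLaminar Cstar) (hTu : T.points = Finset.univ)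

/-- The exponential potential of a clustering, set to zero at the target. -/
noncomputable def expPotential (T : HTree X) (Cstar : Clustering X) (C : Finset (Finset X)) :
    ENNReal :=
  if C = Cstar.parts then 0 else 2 ^ (potential T Cstar C).toNat

include hT hTu

theorem potential_nonneg {C : Finset (Finset X)} (hC : IsPartition C) :
    0 ≤ potential T Cstar C :=
  le_trans (Finset.sum_nonneg fun _ hD => sub_nonneg.2 (one_le_sum_meetInd hC hD))
    (potential_bounds hT hTu hC).1

/-- The exponential potential decreases in the mean by a constant factor in each round. -/
theorem expPotential_step {C : Finset (Finset X)} (hC : IsPartition C) (hne : C ≠ Cstar.parts)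
    {N : ℕ} (hN : potential T Cstar C + 1 ≤ N) (p : PMF (Request X))
    (hfeas : ∀ r ∈ p.support, Feasible Cstar C r)
    (hunif : ∀ M M', FeasibleMerge Cstar C M → FeasibleMerge Cstar C M' →
      p (Request.merge M) = p (Request.merge M')) :
    ∑' r, p r * expPotential T Cstar (respond T C r) ≤
      ENNReal.ofReal (1 - 1 / (2 * ((2 * N : ℕ) + 1))) * expPotential T Cstar C := by
  classical
  set half : Finset (Finset X) → Prop := fun M => ∃ D ∈ Cstar.parts,
    M.sup id ⊆ (T.splitSet D).1 ∨ M.sup id ⊆ (T.splitSet D).2 with hhalf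
  set bad : Finset (Finset (Finset X)) :=
    C.powerset.filter fun M => FeasibleMerge Cstar C M ∧ half M with hbad
  set good : Finset (Finset (Finset X)) :=
    C.powerset.filter fun M => FeasibleMerge Cstar C M ∧ ¬ half M with hgood
  have hcard : bad.card ≤ N * (2 * good.card) := by
    refine card_merge_le hT hTu hC (fun D hD => ?_) (fun M hM => (Finset.mem_filter.1 hM).2) ?_
    · have := card_meet_le hT hTu hC hD
      omega
    · exact fun M hM hM' => Finset.mem_filter.2 ⟨Finset.mem_powerset.2 hM.1, hM, hM'⟩
  have hinj : Function.Injective (Request.merge : Finset (Finset X) → Request X) :=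
    fun M M' h => by injection h
  have hmass : ∑ r ∈ bad.map ⟨_, hinj⟩, p r ≤
      ((2 * N : ℕ) : ENNReal) * ∑ r ∈ good.map ⟨_, hinj⟩, p r := by
    rw [Finset.sum_map, Finset.sum_map]
    simp only [Function.Embedding.coeFn_mk]
    rcases bad.eq_empty_or_nonempty with h | ⟨M₀, hM₀⟩
    · simp [h]
    · have hf := (Finset.mem_filter.1 hM₀).2.1
      rw [Finset.sum_congr rfl fun M hM => hunif M M₀ (Finset.mem_filter.1 hM).2.1 hf,
        Finset.sum_congr (s₁ := good) rfl
          fun M hM => hunif M M₀ (Finset.mem_filter.1 hM).2.1 hf,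
        Finset.sum_const, Finset.sum_const, nsmul_eq_mul, nsmul_eq_mul, ← mul_assoc]
      gcongr
      rw [← Nat.cast_mul, Nat.cast_le]
      linarith
  have hdisj : Disjoint (bad.map ⟨Request.merge, hinj⟩) (good.map ⟨Request.merge, hinj⟩) := by
    rw [Finset.disjoint_map]
    exact Finset.disjoint_left.2 fun M h h' => (Finset.mem_filter.1 h').2.2 (Finset.mem_filter.1 h).2.2
  refine tsum_mul_le_of_half p hdisj hmass ?_ ?_
  · intro r hr
    obtain ⟨hC', hle, -⟩ := respond_spec hT hTu hC (hfeas r hr)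
    unfold expPotential
    rw [if_neg hne]
    split_ifs
    · simp
    · refine pow_le_pow_right₀ (by norm_num) (Int.toNat_le_toNat ?_)
      exact sub_le_sub_right hle _
  · intro r hr hrs
    obtain ⟨hC', -, hlt⟩ := respond_spec hT hTu hC (hfeas r hr)
    unfold expPotential
    rw [if_neg hne]
    split_ifs
    · simp
    · rcases hlt with hlt | ⟨M, rfl, hM⟩
      · have h0 := potential_nonneg hT hTu hC'
        have h1 : potential T Cstar (respond T C r) < potential T Cstar C :=
          sub_lt_sub_right hlt _
        -- A drop of the integer potential by at least one halves the power of two; nonnegativity is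
        -- needed for `toNat` to drop as well.
        rw [ENNReal.le_div_iff_mul_le (by simp) (by simp), ← pow_succ]
        exact pow_le_pow_right₀ (by norm_num) (by omega)
      · have hf : FeasibleMerge Cstar C M := hfeas _ hr
        refine absurd (Finset.mem_map.2 ⟨M, ?_, rfl⟩) hrs
        exact Finset.mem_filter.2 ⟨Finset.mem_powerset.2 hf.1, hf, hM⟩

variable {user : List (Request X) → PMF (Request X)}
  (huser : IsUnrestrictedRandomMergeUser T Cstar C₀ user)

include huser

theorem isPartition_current (n : ℕ) : ∀ h ∈ (history T Cstar C₀ user n).support,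
    IsPartition (current T C₀.parts h) ∧
      potential T Cstar (current T C₀.parts h) ≤ potential T Cstar C₀.parts := by
  induction n with
  | zero =>
    intro h hh
    rw [history, PMF.support_pure, Set.mem_singleton_iff] at hh
    subst hh
    exact ⟨isPartition_parts C₀, le_rfl⟩
  | succ n ih =>
    intro h hh
    rw [history, PMF.mem_support_bind_iff] at hh
    obtain ⟨h', hh', hh⟩ := hh
    obtain ⟨hp, hle⟩ := ih h' hh'
    split_ifs at hh with heq
    · rw [PMF.support_pure, Set.mem_singleton_iff] at hh
      subst hh
      exact ⟨hp, hle⟩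
    · rw [PMF.mem_support_map_iff] at hh
      obtain ⟨r, hr, rfl⟩ := hh
      obtain ⟨hp', hle', -⟩ := respond_spec hT hTu hp ((huser n h' hh' heq).1 r hr)
      exact ⟨hp', (sub_le_sub_right hle' _).trans hle⟩

theorem tsum_expPotential_le {N : ℕ} (hN : potential T Cstar C₀.parts + 1 ≤ N) (n : ℕ) :
    ∑' h, history T Cstar C₀ user n h * expPotential T Cstar (current T C₀.parts h) ≤
      ENNReal.ofReal (1 - 1 / (2 * ((2 * N : ℕ) + 1))) ^ n *
        2 ^ (potential T Cstar C₀.parts).toNat := by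
  induction n with
  | zero =>
    rw [history, tsum_pure_mul, pow_zero, one_mul, current, expPotential]
    split_ifs <;> simp
  | succ n ih =>
    rw [history, tsum_bind_mul]
    refine le_trans (ENNReal.tsum_le_tsum (g := fun h =>
      ENNReal.ofReal (1 - 1 / (2 * ((2 * N : ℕ) + 1))) * (history T Cstar C₀ user n h *
        expPotential T Cstar (current T C₀.parts h))) fun h => ?_) ?_
    · by_cases hh : history T Cstar C₀ user n h = 0
      · simp [hh]
      rw [mul_left_comm]
      gcongr
      have hs := (PMF.mem_support_iff _ _).2 hh
      obtain ⟨hp, hle⟩ := isPartition_current hT hTu huser n h hs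
      split_ifs with heq
      · rw [tsum_pure_mul, expPotential, if_pos heq, mul_zero]
      · rw [tsum_map_mul]
        -- The potential never increases, so the `N` chosen for the initial clustering serves in
        -- every round.
        exact expPotential_step hT hTu hp heq (by linarith) _ (huser n h hs heq).1
          (huser n h hs heq).2
    · rw [ENNReal.tsum_mul_left, pow_succ', mul_assoc]
      gcongr

/-- The failure probability decays exponentially in the number of requests. -/
theorem le_probFoundWithin {N : ℕ} (hN : potential T Cstar C₀.parts + 1 ≤ N) (n : ℕ) {δ : ℝ}
    (hδ : (1 - 1 / (2 * (2 * N + 1) : ℝ)) ^ n * 2 ^ N ≤ δ) :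
    ENNReal.ofReal (1 - δ) ≤ probFoundWithin T Cstar C₀ user n := by
  classical
  have h0 := potential_nonneg hT hTu (isPartition_parts C₀)
  have hρ : (0 : ℝ) ≤ 1 - 1 / (2 * (2 * N + 1) : ℝ) := by
    rw [sub_nonneg, div_le_one (by positivity)]
    have : (0 : ℝ) ≤ N := by positivity
    linarith
  have hδ0 : 0 ≤ δ := le_trans (by positivity) hδ
  have hW : ∑' h, history T Cstar C₀ user n h * expPotential T Cstar (current T C₀.parts h) ≤
      ENNReal.ofReal δ := by
    refine (tsum_expPotential_le hT hTu huser hN n).trans ?_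
    calc _ ≤ ENNReal.ofReal (1 - 1 / (2 * ((2 * N : ℕ) + 1))) ^ n * 2 ^ N := by
          gcongr
          · norm_num
          · omega
      _ = ENNReal.ofReal ((1 - 1 / (2 * (2 * N + 1) : ℝ)) ^ n * 2 ^ N) := by
          rw [ENNReal.ofReal_mul (by positivity), ENNReal.ofReal_pow hρ,
            ENNReal.ofReal_pow (by norm_num)]
          norm_num
      _ ≤ _ := ENNReal.ofReal_le_ofReal hδ
  have h1 : (1 : ENNReal) ≤ probFoundWithin T Cstar C₀ user n + ENNReal.ofReal δ := by
    rw [← (history T Cstar C₀ user n).tsum_coe, probFoundWithin, PMF.toOuterMeasure_apply]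
    refine le_trans ?_ (add_le_add_right hW _)
    rw [← ENNReal.tsum_add]
    refine ENNReal.tsum_le_tsum fun h => ?_
    by_cases heq : current T C₀.parts h = Cstar.parts
    · rw [Set.indicator_of_mem (by exact heq)]
      exact le_self_add
    · rw [expPotential, if_neg heq]
      -- Markov's inequality: off the target `expPotential` is at least 1.
      refine le_trans ?_ le_add_self
      exact le_mul_of_one_le_right' (one_le_pow₀ (by norm_num))
  rw [ENNReal.ofReal_sub _ hδ0, ENNReal.ofReal_one]
  exact tsub_le_iff_right.2 h1

end Interaction

/-- The number of rounds after which the bound for the failure probability is at most `ε`. -/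
theorem failure_bound {g : ℕ} (hg : 1 ≤ g) {k ε : ℝ} (hk : 1 ≤ k) (hε : 0 < ε)
    (h2 : 2 ≤ k / ε) :
    (1 - 1 / (2 * (2 * (4 * g + 1 : ℕ) + 1) : ℝ)) ^ ⌊(200 : ℝ) * (Real.log (k / ε) * g ^ 2)⌋₊ *
      2 ^ (4 * g + 1) ≤ ε := by
  set n := ⌊(200 : ℝ) * (Real.log (k / ε) * g ^ 2)⌋₊ with hn
  set L := Real.log (k / ε) with hL
  have hg1 : (1 : ℝ) ≤ g := by exact_mod_cast hg
  have hL2 : Real.log 2 ≤ L := Real.log_le_log (by norm_num) h2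
  have hlog2 := Real.log_two_gt_d9
  have hL0 : 1 / 2 ≤ L := by linarith
  have hLε : -Real.log ε ≤ L := by
    rw [hL, Real.log_div (by positivity) hε.ne']
    linarith [Real.log_nonneg hk]
  have hn1 : 200 * (L * (g : ℝ) ^ 2) < n + 1 := Nat.lt_floor_add_one _
  have hg2 : (1 : ℝ) ≤ (g : ℝ) ^ 2 := one_le_pow₀ hg1
  -- The floor loses less than 1, which is at most `2 * (L * g ^ 2)` because `L ≥ 1 / 2` and `g ≥
  -- 1`.
  have hn2 : 198 * (L * (g : ℝ) ^ 2) ≤ n := by nlinarith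
  set c : ℝ := 2 * (2 * (4 * g + 1 : ℕ) + 1) with hc
  -- Here `c = 16 * g + 6` and `g ≥ 1`; moreover `198 = 9 * 22`.
  have hcg : c ≤ 22 * g := by
    rw [hc]; push_cast; linarith
  have hc0 : 0 < c := by positivity
  have hρ : (0 : ℝ) ≤ 1 - 1 / c := by
    rw [sub_nonneg, div_le_one hc0, hc]
    push_cast
    linarith
  have hpow : (1 - 1 / c) ^ n ≤ Real.exp (-(n / c)) := by
    calc (1 - 1 / c) ^ n ≤ Real.exp (-(1 / c)) ^ n :=
          pow_le_pow_left₀ hρ (Real.one_sub_le_exp_neg _) n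
      _ = _ := by
          rw [← Real.exp_nat_mul]
          congr 1
          ring
  have h2pow : (2 : ℝ) ^ (4 * g + 1) = Real.exp ((4 * g + 1) * Real.log 2) := by
    rw [← Real.exp_log (show (0 : ℝ) < 2 ^ (4 * g + 1) by positivity), Real.log_pow]
    push_cast
    rfl
  have hnc : 9 * (L * g) ≤ n / c := by
    rw [le_div_iff₀ hc0]
    have : 0 ≤ 9 * (L * g) := by positivity
    calc 9 * (L * g) * c ≤ 9 * (L * g) * (22 * g) := by gcongr
      _ = 198 * (L * (g : ℝ) ^ 2) := by ring
      _ ≤ n := hn2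
  calc (1 - 1 / c) ^ n * 2 ^ (4 * g + 1) ≤
        Real.exp (-(n / c)) * Real.exp ((4 * g + 1) * Real.log 2) := by
        rw [h2pow]; gcongr
    _ = Real.exp (-(n / c) + (4 * g + 1) * Real.log 2) := (Real.exp_add _ _).symm
    _ ≤ Real.exp (Real.log ε) := by
        apply Real.exp_le_exp.2
        have e1 : (4 * g + 1) * Real.log 2 ≤ (4 * g + 1) * L := by gcongr
        have e2 : L ≤ L * g := le_mul_of_one_le_right (by linarith) hg1
        -- The exponent is at most `-9 * L * g + 4 * L * g + L ≤ -4 * L * g ≤ -L ≤ log ε`.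
        nlinarith
    _ = ε := Real.exp_log hε

end InteractiveClustering

open InteractiveClustering
theorem mainTheorem9 :
    ∃ K : ℝ, 0 < K ∧
      ∀ (X : Type*) [Fintype X] [DecidableEq X]
        (S : X → X → ℝ) (_ : ∀ x y, S x y = S y x)
        (Cstar : Clustering X) (_ : IsStable S Cstar)
        (T : HTree X) (_ : IsAvgLinkageTree S T)
        (γ : Clustering X → Clustering X → ℤ) (_ : IsNaturalError γ)
        (C₀ : Clustering X)
        (user : List (Request X) → PMF (Request X))
        (_ : IsUnrestrictedRandomMergeUser T Cstar C₀ user)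
        (ε : ℝ) (_ : 0 < ε) (_ : ε < 1) (_ : 2 ≤ (Cstar.parts.card : ℝ) / ε),
        ENNReal.ofReal (1 - ε) ≤
          probFoundWithin T Cstar C₀ user
            ⌊K * (Real.log ((Cstar.parts.card : ℝ) / ε) * (γ C₀ Cstar : ℝ) ^ 2)⌋₊ := by
  refine ⟨200, by norm_num, ?_⟩
  intro X _ _ S hS Cstar hstab T hT γ hγ C₀ user huser ε hε hε1 h2
  obtain ⟨hlam, hTu⟩ := isLaminar_of_isAvgLinkageTree hS hstab hT
  by_cases hne : C₀.parts = Cstar.parts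
  -- Starting at the target, the interaction never moves, so any number of rounds works, including
  -- zero.
  · have h0 : ∀ n, history T Cstar C₀ user n = PMF.pure [] := by
      intro n
      induction n with
      | zero => rfl
      | succ n ih => rw [history, ih, PMF.pure_bind, current, if_pos hne]
    rw [probFoundWithin, h0, PMF.toOuterMeasure_pure_apply, if_pos (by exact hne)]
    exact ENNReal.ofReal_le_one.2 (by linarith)
  -- Off the target some edit strictly lowers the nonnegative error, so the error is positive; this
  -- gives `1 ≤ g`.
  · obtain ⟨C', hlt, -⟩ := hγ.exists_lt hne
    have hγ1 : 0 < γ C₀ Cstar := (hγ.nonneg C' Cstar).trans_lt hlt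
    obtain ⟨g, hg⟩ := Int.eq_ofNat_of_zero_le hγ1.le
    have hpot : potential T Cstar C₀.parts + 1 ≤ (4 * g + 1 : ℕ) := by
      have h1 := (potential_bounds hlam hTu (isPartition_parts C₀)).2
      have h3 := hγ.sum_errWeight_le (Cstar := Cstar) C₀
      push_cast
      linarith
    have hk : (1 : ℝ) ≤ Cstar.parts.card := by
      rw [Nat.one_le_cast, Nat.one_le_iff_ne_zero]
      intro h
      rw [h] at h2
      norm_num at h2
    refine le_probFoundWithin hlam hTu huser hpot _ ?_
    rw [hg]
    exact failure_bound (by omega) hk hε h2
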